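/- **Proposition (heat kernel upper bound).** Let $d\ge 1$ be an integer and let $\mathfrak c\in\mathbb N$. There is a constant $c>0$ depending only on $d$ and $\mathfrak c$ such that the following holds for every environment $\boldsymbol\alpha=(\alpha_z)_{z\in\mathbb Z^d}\in\{1,\dots,\mathfrak c\}^{\mathbb Z^d}$. For $x\in\mathbb Z^d$ let $X^{\boldsymbol\alpha,x}=\{X^{\boldsymbol\alpha,x}_t,\ t\ge 0\}$ be the random walk in the environment $\boldsymbol\alpha$ started at $x$, that is, the (càdlàg) continuous-time Markov process on $\mathbb Z^d$ started at $x$ whose infinitesimal generator acts on bounded functions $f:\mathbb Z^d\to\mathbb R$ by $$A^{\boldsymbol\alpha}f(z)=\sum_{y\in\mathbb Z^d,\ |y-z|=1}\alpha_y\,\bigl(f(y)-f(z)\bigr),\qquad z\in\mathbb Z^d,$$ where $|\cdot|$ denotes the Euclidean norm; write $P^{\boldsymbol\alpha}$ for its law. Then, for all $t>0$ and all $x,y\in\mathbb Z^d$, $$P^{\boldsymbol\alpha}\bigl(X^{\boldsymbol\alpha,x}_t=y\bigr)\ \le\ \frac{c}{1\vee\sqrt{t^d}}\,\exp\Bigl(-\frac{|x-y|}{1\vee\sqrt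 t}\Bigr).$$ -/

import Mathlib

open MeasureTheory ProbabilityTheory Filter Topology
open scoped NNReal

/-- The Euclidean norm of a point of the lattice `ℤ^d`. -/
noncomputable def euclNorm {d : ℕ} (z : Fin d → ℤ) : ℝ :=
  ‖(WithLp.toLp 2 (fun i => (z i : ℝ)) : EuclideanSpace ℝ (Fin d))‖

theorem euclNorm_sq {d : ℕ} (z : Fin d → ℤ) : euclNorm z ^ 2 = ∑ i, (z i : ℝ) ^ 2 := by
  simp [euclNorm, EuclideanSpace.norm_sq_eq]

open Classical in
/-- The nearest neighbours of `x` in `ℤ^d`, i.e. the points `y` with `|y - x| = 1`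
(cut out of a finite box only to have a finite set; see `mem_neighbors`). -/
noncomputable def neighbors {d : ℕ} (x : Fin d → ℤ) : Finset (Fin d → ℤ) :=
  (Finset.Icc (x - 1) (x + 1)).filter (fun y => euclNorm (y - x) = 1)

theorem mem_neighbors {d : ℕ} (x y : Fin d → ℤ) : y ∈ neighbors x ↔ euclNorm (y - x) = 1 := by
  classical
  simp only [neighbors, Finset.mem_filter, Finset.mem_Icc, and_iff_right_iff_imp]
  intro h
  have hsq := euclNorm_sq (y - x)
  rw [h] at hsq
  have key : ∀ i, |y i - x i| ≤ 1 := by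
    intro i
    have h1 : (((y - x) i : ℤ) : ℝ) ^ 2 ≤ ∑ j, (((y - x) j : ℤ) : ℝ) ^ 2 :=
      Finset.single_le_sum (f := fun j => (((y - x) j : ℤ) : ℝ) ^ 2)
        (fun j _ => sq_nonneg _) (Finset.mem_univ i)
    rw [← hsq] at h1
    have h2 : (y i - x i) ^ 2 ≤ 1 ^ 2 := by
      have : (((y i - x i) ^ 2 : ℤ) : ℝ) ≤ ((1 ^ 2 : ℤ) : ℝ) := by
        push_cast
        simpa using h1
      exact_mod_cast this
    simpa using sq_le_sq.mp h2
  constructor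
  · intro i
    have := abs_le.mp (key i)
    simp only [Pi.sub_apply, Pi.one_apply]
    omega
  · intro i
    have := abs_le.mp (key i)
    simp only [Pi.add_apply, Pi.one_apply]
    omega

/-- The operator `A^α f (x) = ∑_{y : |y - x| = 1} α_y (f(y) - f(x))`. -/
noncomputable def rwGenerator {d : ℕ} (α : (Fin d → ℤ) → ℕ) (f : (Fin d → ℤ) → ℝ)
    (x : Fin d → ℤ) : ℝ :=
  ∑ y ∈ neighbors x, (α y : ℝ) * (f y - f x)

/-- A Markov semigroup of transition kernels: `κ t x` is the law at time `t` of the process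
started at `x`. -/
structure IsMarkovSemigroup {E : Type*} [MeasurableSpace E] (κ : ℝ≥0 → Kernel E E) : Prop where
  markov : ∀ t, IsMarkovKernel (κ t)
  zero : κ 0 = Kernel.id
  /-- Chapman–Kolmogorov equation -/
  add : ∀ s t, κ (s + t) = κ t ∘ₖ κ s

/-- The infinitesimal generator of the semigroup `S_t f (x) = ∫ f dκ_t(x, ·)`, acting on the
bounded (measurable) functions with the supremum norm, is everywhere defined and equal to `A`:
`(S_t f - f) / t → A f` uniformly as `t ↓ 0`. -/
def HasGenerator {E : Type*} [MeasurableSpace E] (κ : ℝ≥0 → Kernel E E)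
    (A : (E → ℝ) → E → ℝ) : Prop :=
  ∀ f : E → ℝ, Measurable f → (∃ C, ∀ x, |f x| ≤ C) →
    TendstoUniformly (fun (t : ℝ≥0) x => (∫ y, f y ∂(κ t x) - f x) / (t : ℝ)) (A f) (𝓝[>] 0)

/-- The σ-algebra `σ(X_u, u ≤ s)` of the natural filtration of `X`. -/
abbrev pastOf {Ω E : Type*} [MeasurableSpace E] (X : ℝ≥0 → Ω → E) (s : ℝ≥0) : MeasurableSpace Ω :=
  ⨆ u ≤ s, MeasurableSpace.comap (X u) inferInstance

/-- Under `P`, `X` is a càdlàg Markov process, with respect to its natural filtration, with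
transition semigroup `κ` and starting point `x`. -/
structure IsMarkovProcess {Ω E : Type*} [MeasurableSpace Ω] [MeasurableSpace E]
    [TopologicalSpace E] (κ : ℝ≥0 → Kernel E E) (x : E) (P : Measure Ω)
    (X : ℝ≥0 → Ω → E) : Prop where
  measurable : ∀ t, Measurable (X t)
  start : ∀ᵐ ω ∂P, X 0 ω = x
  rightCts : ∀ᵐ ω ∂P, ∀ t, ContinuousWithinAt (fun u => X u ω) (Set.Ici t) t
  leftLim : ∀ᵐ ω ∂P, ∀ t, ∃ l, Tendsto (fun u => X u ω) (𝓝[<] t) (𝓝 l)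
  /-- Markov property `E[f(X_{s+t}) | σ(X_u, u ≤ s)] = S_t f (X_s)` -/
  markov : ∀ s t, ∀ f : E → ℝ, Measurable f → (∃ C, ∀ z, |f z| ≤ C) →
    P[fun ω => f (X (s + t) ω) | pastOf X s] =ᵐ[P] fun ω => ∫ z, f z ∂(κ t (X s ω))

/-- Under `P`, `X` is the random walk `RW(α)` in the environment `α` started at `x`: the
continuous-time Markov process on `ℤ^d` with infinitesimal generator `A^α`. -/
def IsRandomWalk {d : ℕ} (α : (Fin d → ℤ) → ℕ) (x : Fin d → ℤ) {Ω : Type*} [MeasurableSpace Ω]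
    (P : Measure Ω) (X : ℝ≥0 → Ω → (Fin d → ℤ)) : Prop :=
  ∃ κ : ℝ≥0 → Kernel (Fin d → ℤ) (Fin d → ℤ),
    IsMarkovSemigroup κ ∧ HasGenerator κ (rwGenerator α) ∧ IsMarkovProcess κ x P X

/-! Write `p_t(z,y)` for the transition probabilities. The walk jumps from `z` to a neighbour `w` at
rate `α_w`, so `α_z α_w` is symmetric: the walk is reversible with respect to `α`, with conductances
in `[1, 𝔠²]`. Nash's argument is combined with Davies' exponential weights. The quantity to control
is `E_l(t) = ∑_z α_z (e^{l|z-y|₁} p_t(z,y))²`; the core estimate (`exists_weightedEnergy_bound`) is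
`E_{1/m}(t) ≤ B m^{-d}` with `m = 1 ∨ √t`. Splitting the path at half time, with reversibility, the
triangle inequality and Cauchy–Schwarz (`IsMarkovSemigroup.exp_mul_real_le`), turns it into the
pointwise bound, even with the larger `ℓ¹` distance in the exponent.

Conjugating the generator by the weight costs only a term `4dc l² E_l` in the energy estimate
(`inner_tiltedGenerator_le`). The Dirichlet form is bounded below by averaging over boxes of side
`r` (`SqSummable.norm_sq_le_dirichlet`), at the price of the `ℓ¹` norm. The weighted `ℓ¹` norm is
not conserved, so it is interpolated between the mass and `E_{3l}`
(`IsMarkovSemigroup.summable_exp_mul_real`).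

This suggests an induction from `s = t/9` to `t`, since `3/√t = 1/√s`. If `E_{1/√s}(s) ≤ S²
s^{-d/2}`, the square of the weighted mass on `[s,t]` is at most `Λ S`. With `r` a small fraction of
`√t`, Grönwall gives `E_{1/√t}(t) ≤ (S²/2 + C S) t^{-d/2}`: the new term is linear in `S`, so the
induction closes once `S ≥ 2C`.

No decay of `p_t` is known beforehand. The weighted equation is therefore solved in `ℓ²`, where the
conjugated generator is bounded, and its solution is identified with the weighted kernel by
uniqueness of bounded solutions (`heat_unique`). The same uniqueness yields reversibility of the
semigroup. -/

/-! ### Lattice norms and the generator -/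

/-- The `i`-th unit vector of `ℤ^d`. -/
abbrev unitVec {d : ℕ} (i : Fin d) : Fin d → ℤ := Pi.single i 1

/-- The `ℓ¹` norm of a point of the lattice `ℤ^d`. -/
noncomputable def l1Norm {d : ℕ} (z : Fin d → ℤ) : ℝ := ∑ i, |(z i : ℝ)|

theorem l1Norm_nonneg {d : ℕ} (z : Fin d → ℤ) : 0 ≤ l1Norm z :=
  Finset.sum_nonneg fun _ _ => abs_nonneg _

theorem l1Norm_zero {d : ℕ} : l1Norm (0 : Fin d → ℤ) = 0 := by simp [l1Norm]

theorem l1Norm_neg {d : ℕ} (z : Fin d → ℤ) : l1Norm (-z) = l1Norm z := by simp [l1Norm]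

theorem l1Norm_sub_comm {d : ℕ} (z w : Fin d → ℤ) : l1Norm (z - w) = l1Norm (w - z) := by
  rw [← l1Norm_neg, neg_sub]

theorem l1Norm_add_le {d : ℕ} (z w : Fin d → ℤ) : l1Norm (z + w) ≤ l1Norm z + l1Norm w := by
  rw [l1Norm, l1Norm, l1Norm, ← Finset.sum_add_distrib]
  refine Finset.sum_le_sum fun i _ => ?_
  simpa using abs_add_le (z i : ℝ) (w i : ℝ)

theorem l1Norm_unitVec {d : ℕ} (i : Fin d) : l1Norm (unitVec i) = 1 := by
  rw [l1Norm, Finset.sum_eq_single i]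
  · simp
  · intro j _ hj
    simp [Pi.single_eq_of_ne hj]
  · simp

theorem abs_l1Norm_add_unitVec_sub {d : ℕ} (z : Fin d → ℤ) (i : Fin d) :
    |l1Norm (z + unitVec i) - l1Norm z| ≤ 1 := by
  have h1 := l1Norm_add_le z (unitVec i)
  have h2 := l1Norm_add_le (z + unitVec i) (-unitVec i)
  rw [add_neg_cancel_right, l1Norm_neg] at h2
  rw [l1Norm_unitVec] at h1 h2
  exact abs_le.2 ⟨by linarith, by linarith⟩

theorem euclNorm_nonneg {d : ℕ} (z : Fin d → ℤ) : 0 ≤ euclNorm z := norm_nonneg _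

theorem euclNorm_le_l1Norm {d : ℕ} (z : Fin d → ℤ) : euclNorm z ≤ l1Norm z := by
  refine le_of_sq_le_sq ?_ (l1Norm_nonneg z)
  rw [euclNorm_sq, l1Norm]
  calc ∑ i, (z i : ℝ) ^ 2 = ∑ i, |(z i : ℝ)| ^ 2 := by simp
    _ ≤ (∑ i, |(z i : ℝ)|) ^ 2 := Finset.sum_sq_le_sq_sum_of_nonneg fun _ _ => abs_nonneg _

theorem euclNorm_eq_one_iff {d : ℕ} (z : Fin d → ℤ) :
    euclNorm z = 1 ↔ ∃ i, z = unitVec i ∨ z = -unitVec i := by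
  have key : euclNorm z = 1 ↔ ∑ i, z i ^ 2 = 1 := by
    rw [← sq_eq_sq₀ (euclNorm_nonneg z) zero_le_one, euclNorm_sq]
    norm_cast
  rw [key]
  constructor
  · intro h
    obtain ⟨i, hi⟩ : ∃ i, z i ≠ 0 := by
      by_contra! hc
      simp [hc] at h
    have hsplit := Finset.add_sum_erase Finset.univ (fun j => z j ^ 2) (Finset.mem_univ i)
    have hpos : 0 < z i ^ 2 := by positivity
    have hrest : 0 ≤ ∑ j ∈ Finset.univ.erase i, z j ^ 2 :=
      Finset.sum_nonneg fun _ _ => sq_nonneg _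
    have h0 : ∑ j ∈ Finset.univ.erase i, z j ^ 2 = 0 := by omega
    have h1 : z i ^ 2 = 1 := by omega
    have hz : ∀ j, j ≠ i → z j = 0 := by
      intro j hj
      have := (Finset.sum_eq_zero_iff_of_nonneg fun k _ => sq_nonneg (z k)).1 h0 j (by simp [hj])
      exact pow_eq_zero_iff (two_ne_zero) |>.1 this
    refine ⟨i, ?_⟩
    rcases sq_eq_one_iff.1 h1 with h | h
    · left
      ext j
      by_cases hj : j = i
      · subst hj; simpa using h
      · simp [hj, hz j hj]
    · right
      ext j
      by_cases hj : j = i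
      · subst hj; simpa using h
      · simp [hj, hz j hj]
  · rintro ⟨i, rfl | rfl⟩
    · rw [Finset.sum_eq_single i] <;> simp +contextual
    · rw [Finset.sum_eq_single i] <;> simp +contextual

theorem unitVec_injective {d : ℕ} : Function.Injective (unitVec : Fin d → Fin d → ℤ) := by
  intro i j h
  by_contra hij
  have := congrFun h i
  simp [Pi.single_eq_of_ne hij] at this

theorem sum_neighbors {d : ℕ} (z : Fin d → ℤ) (φ : (Fin d → ℤ) → ℝ) :
    ∑ w ∈ neighbors z, φ w = ∑ i, (φ (z + unitVec i) + φ (z - unitVec i)) := by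
  classical
  have h : neighbors z = Finset.univ.image (fun i => z + unitVec i) ∪
      Finset.univ.image (fun i => z - unitVec i) := by
    ext w
    rw [mem_neighbors, euclNorm_eq_one_iff]
    simp only [Finset.mem_union, Finset.mem_image, Finset.mem_univ, true_and]
    constructor
    · rintro ⟨i, h | h⟩
      · exact Or.inl ⟨i, by rw [← h]; abel⟩
      · exact Or.inr ⟨i, by rw [sub_eq_add_neg, ← h]; abel⟩
    · rintro (⟨i, rfl⟩ | ⟨i, rfl⟩)
      · exact ⟨i, Or.inl (by abel)⟩
      · exact ⟨i, Or.inr (by abel)⟩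
  rw [h, Finset.sum_union, Finset.sum_image, Finset.sum_image, Finset.sum_add_distrib]
  · intro i _ j _ hij
    exact unitVec_injective (sub_right_injective hij)
  · intro i _ j _ hij
    exact unitVec_injective (add_right_injective z hij)
  · rw [Finset.disjoint_left]
    intro w hw hw'
    simp only [Finset.mem_image, Finset.mem_univ, true_and] at hw hw'
    obtain ⟨i, rfl⟩ := hw
    obtain ⟨j, hj⟩ := hw'
    have := congrFun hj i
    simp only [Pi.sub_apply, Pi.add_apply, Pi.single_eq_same] at this
    by_cases hij : i = j
    · subst hij; simp at this; omega
    · simp [hij] at this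

theorem rwGenerator_eq {d : ℕ} (α : (Fin d → ℤ) → ℕ) (f : (Fin d → ℤ) → ℝ) (z : Fin d → ℤ) :
    rwGenerator α f z = ∑ i, ((α (z + unitVec i) : ℝ) * (f (z + unitVec i) - f z) +
      (α (z - unitVec i) : ℝ) * (f (z - unitVec i) - f z)) :=
  sum_neighbors z _

theorem abs_rwGenerator_le {d : ℕ} {α : (Fin d → ℤ) → ℕ} {c : ℕ} (hα : ∀ z, α z ≤ c)
    {f : (Fin d → ℤ) → ℝ} {M : ℝ} (hf : ∀ z, |f z| ≤ M) (z : Fin d → ℤ) :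
    |rwGenerator α f z| ≤ 4 * d * c * M := by
  have hM : 0 ≤ M := (abs_nonneg _).trans (hf z)
  have hterm : ∀ w, |(α w : ℝ) * (f w - f z)| ≤ 2 * c * M := by
    intro w
    rw [abs_mul, Nat.abs_cast]
    have h1 : (α w : ℝ) ≤ c := by exact_mod_cast hα w
    have h2 : |f w - f z| ≤ 2 * M := by
      have := abs_sub (f w) (f z)
      linarith [hf w, hf z]
    calc (α w : ℝ) * |f w - f z| ≤ c * (2 * M) := by gcongr
      _ = 2 * c * M := by ring
  rw [rwGenerator_eq]
  calc _ ≤ ∑ i : Fin d, (2 * c * M + 2 * c * M) := by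
        refine (Finset.abs_sum_le_sum_abs _ _).trans (Finset.sum_le_sum fun i _ => ?_)
        exact (abs_add_le _ _).trans (add_le_add (hterm _) (hterm _))
    _ = 4 * d * c * M := by simp; ring

/-! ### Exponential sums over the lattice -/

/-- Geometric sum over the integers. -/
theorem sum_exp_neg_abs_int_le {b : ℝ} (hb : 0 < b) (hb1 : b ≤ 2) (s : Finset ℤ) :
    ∑ k ∈ s, Real.exp (-(b * |(k : ℝ)|)) ≤ 6 / b := by
  set ρ := Real.exp (-b) with hρ
  have hρ0 : 0 < ρ := Real.exp_pos _
  have hρ1 : ρ < 1 := by rw [hρ, Real.exp_lt_one_iff]; linarith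
  have hpow : ∀ n : ℕ, Real.exp (-(b * n)) = ρ ^ n := by
    intro n; rw [hρ, ← Real.exp_nat_mul]; congr 1; ring
  have hgeo := hasSum_geometric_of_lt_one hρ0.le hρ1
  have hn : ∀ n : ℕ, |((-(n + 1 : ℤ) : ℤ) : ℝ)| = ((n + 1 : ℕ) : ℝ) := by
    intro n
    push_cast
    rw [abs_neg, abs_of_nonneg (by positivity)]
  have h : HasSum (fun k : ℤ => Real.exp (-(b * |(k : ℝ)|))) ((1 - ρ)⁻¹ + ρ * (1 - ρ)⁻¹) := by
    refine HasSum.of_nat_of_neg_add_one ?_ ?_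
    · simpa only [Int.cast_natCast, Nat.abs_cast, hpow] using hgeo
    · simpa only [hn, hpow, pow_succ'] using hgeo.mul_left ρ
  refine (sum_le_hasSum s (fun _ _ => (Real.exp_pos _).le) h).trans ?_
  have h3 : ρ ≤ 1 / (1 + b) := by
    rw [hρ, Real.exp_neg, ← one_div]
    exact one_div_le_one_div_of_le (by linarith) (by linarith [Real.add_one_le_exp b])
  have h4 : b / (1 + b) ≤ 1 - ρ := by
    have : b / (1 + b) = 1 - 1 / (1 + b) := by field_simp; ring
    linarith
  have h5 : (1 - ρ)⁻¹ ≤ (1 + b) / b := by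
    rw [← inv_div]
    exact inv_anti₀ (by positivity) h4
  -- Here `1 + ρ ≤ 2`, and `b ≤ 2` gives `2 (1 + b) ≤ 6`.
  calc (1 - ρ)⁻¹ + ρ * (1 - ρ)⁻¹ = (1 + ρ) * (1 - ρ)⁻¹ := by ring
    _ ≤ 2 * ((1 + b) / b) := by gcongr; linarith
    _ ≤ 6 / b := by
      rw [← mul_div_assoc]; gcongr; linarith

theorem sum_exp_neg_l1Norm_le {d : ℕ} {b : ℝ} (hb : 0 < b) (hb1 : b ≤ 2)
    (s : Finset (Fin d → ℤ)) :
    ∑ z ∈ s, Real.exp (-(b * l1Norm z)) ≤ (6 / b) ^ d := by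
  classical
  have hprod : ∀ z : Fin d → ℤ, Real.exp (-(b * l1Norm z)) =
      ∏ i, Real.exp (-(b * |(z i : ℝ)|)) := by
    intro z
    rw [← Real.exp_sum, l1Norm, Finset.mul_sum, Finset.sum_neg_distrib]
  set T : Fin d → Finset ℤ := fun i => s.image (fun z => z i)
  calc ∑ z ∈ s, Real.exp (-(b * l1Norm z))
      ≤ ∑ z ∈ Fintype.piFinset T, Real.exp (-(b * l1Norm z)) := by
        refine Finset.sum_le_sum_of_subset_of_nonneg ?_ fun _ _ _ => (Real.exp_pos _).le
        intro z hz
        rw [Fintype.mem_piFinset]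
        exact fun i => Finset.mem_image_of_mem _ hz
    _ = ∏ i, ∑ k ∈ T i, Real.exp (-(b * |(k : ℝ)|)) := by
        simp_rw [hprod]
        rw [Finset.prod_univ_sum]
    _ ≤ ∏ _i : Fin d, (6 / b) :=
        Finset.prod_le_prod (fun i _ => Finset.sum_nonneg fun _ _ => (Real.exp_pos _).le)
          fun i _ => sum_exp_neg_abs_int_le hb hb1 _
    _ = (6 / b) ^ d := by rw [Finset.prod_const, Finset.card_univ, Fintype.card_fin]

theorem summable_exp_neg_l1Norm {d : ℕ} {b : ℝ} (hb : 0 < b) (hb1 : b ≤ 2) :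
    Summable fun z : Fin d → ℤ => Real.exp (-(b * l1Norm z)) :=
  summable_of_sum_le (fun _ => (Real.exp_pos _).le) (sum_exp_neg_l1Norm_le hb hb1)

theorem tsum_exp_neg_l1Norm_le {d : ℕ} {b : ℝ} (hb : 0 < b) (hb1 : b ≤ 2) (y : Fin d → ℤ) :
    Summable (fun z : Fin d → ℤ => Real.exp (-(b * l1Norm (z - y)))) ∧
    ∑' z : Fin d → ℤ, Real.exp (-(b * l1Norm (z - y))) ≤ (6 / b) ^ d := by
  refine ⟨(Equiv.subRight y).summable_iff.2 (summable_exp_neg_l1Norm hb hb1), ?_⟩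
  refine ((Equiv.subRight y).tsum_eq fun z : Fin d → ℤ => Real.exp (-(b * l1Norm z))).trans_le ?_
  exact (summable_exp_neg_l1Norm hb hb1).tsum_le_of_sum_le (sum_exp_neg_l1Norm_le hb hb1)

/-! ### Uniqueness for the heat equation, linear equations, Grönwall -/

/-- Bounded solutions of the heat equation `u' = A u`, in the coordinatewise sense, that start
from `0` vanish. -/
theorem heat_eq_zero {d : ℕ} {α : (Fin d → ℤ) → ℕ} {c : ℕ} (hα : ∀ z, α z ≤ c)
    {u : ℝ → (Fin d → ℤ) → ℝ} {T M : ℝ}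
    (hbdd : ∀ t ∈ Set.Icc 0 T, ∀ z, |u t z| ≤ M) (h0 : ∀ z, u 0 z = 0)
    (hcont : ∀ z, ContinuousOn (fun t => u t z) (Set.Icc 0 T))
    (hderiv : ∀ t ∈ Set.Ico 0 T, ∀ z,
      HasDerivWithinAt (fun s => u s z) (rwGenerator α (u t) z) (Set.Ici t) t) :
    ∀ t ∈ Set.Icc 0 T, ∀ z, u t z = 0 := by
  set K : ℝ := 4 * d * c
  -- Picard iteration: the generator has norm at most `K` on bounded functions, so each integration
  -- in time improves the bound by one order.
  have hiter : ∀ n : ℕ, ∀ t ∈ Set.Icc 0 T, ∀ z, |u t z| ≤ M * ((K * t) ^ n / n.factorial) := by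
    intro n
    induction n with
    | zero => simpa using hbdd
    | succ n ih =>
      intro t ht z
      refine image_norm_le_of_norm_deriv_right_le_deriv_boundary (f := fun s => u s z)
        (B := fun s => M * ((K * s) ^ (n + 1) / (n + 1).factorial))
        (B' := fun s => K * (M * ((K * s) ^ n / n.factorial)))
        (hcont z) (fun s hs => hderiv s hs z) (by simp [h0]) ?_ ?_ ht
      · intro s
        have h1 : HasDerivAt (fun s : ℝ => K * s) K s := by
          simpa using (hasDerivAt_id s).const_mul K
        refine (((h1.pow (n + 1)).div_const ((n + 1).factorial : ℝ)).const_mul M).congr_deriv ?_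
        rw [Nat.factorial_succ]
        push_cast
        have : (n.factorial : ℝ) ≠ 0 := by positivity
        have : (n : ℝ) + 1 ≠ 0 := by positivity
        field_simp
      · intro s hs
        exact abs_rwGenerator_le hα (ih s ⟨hs.1, hs.2.le⟩) z
  intro t ht z
  have hlim : Tendsto (fun n : ℕ => M * ((K * t) ^ n / n.factorial)) atTop (𝓝 (M * 0)) :=
    (FloorSemiring.tendsto_pow_div_factorial_atTop (K * t)).const_mul M
  rw [mul_zero] at hlim
  exact abs_nonpos_iff.1 (ge_of_tendsto' hlim fun n => hiter n t ht z)

theorem heat_unique {d : ℕ} {α : (Fin d → ℤ) → ℕ} {c : ℕ} (hα : ∀ z, α z ≤ c)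
    {u v : ℝ → (Fin d → ℤ) → ℝ} {T M : ℝ}
    (hu : ∀ t ∈ Set.Icc 0 T, ∀ z, |u t z| ≤ M) (hv : ∀ t ∈ Set.Icc 0 T, ∀ z, |v t z| ≤ M)
    (h0 : ∀ z, u 0 z = v 0 z)
    (hucont : ∀ z, ContinuousOn (fun t => u t z) (Set.Icc 0 T))
    (hvcont : ∀ z, ContinuousOn (fun t => v t z) (Set.Icc 0 T))
    (huderiv : ∀ t ∈ Set.Ico 0 T, ∀ z,
      HasDerivWithinAt (fun s => u s z) (rwGenerator α (u t) z) (Set.Ici t) t)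
    (hvderiv : ∀ t ∈ Set.Ico 0 T, ∀ z,
      HasDerivWithinAt (fun s => v s z) (rwGenerator α (v t) z) (Set.Ici t) t) :
    ∀ t ∈ Set.Icc 0 T, ∀ z, u t z = v t z := by
  intro t ht z
  refine sub_eq_zero.1 (heat_eq_zero hα (u := fun t z => u t z - v t z) (M := 2 * M) ?_ ?_ ?_ ?_
    t ht z)
  · intro s hs w
    have := abs_sub (u s w) (v s w)
    linarith [hu s hs w, hv s hs w]
  · intro w; simp [h0]
  · exact fun w => (hucont w).sub (hvcont w)
  · intro s hs w
    refine ((huderiv s hs w).sub (hvderiv s hs w)).congr_deriv ?_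
    rw [rwGenerator, rwGenerator, rwGenerator, ← Finset.sum_sub_distrib]
    exact Finset.sum_congr rfl fun _ _ => by ring

/-- A linear differential equation in a Banach space is solvable. -/
theorem exists_linear_ode_solution {E : Type*} [NormedAddCommGroup E] [NormedSpace ℝ E]
    [CompleteSpace E] (A : E →L[ℝ] E) (v : E) :
    ∃ f : ℝ → E, f 0 = v ∧ ∀ t, HasDerivAt f (A (f t)) t := by
  refine ⟨fun t => NormedSpace.exp (t • A) v, by simp, fun t => ?_⟩
  have h := hasDerivAt_exp_smul_const' (𝕂 := ℝ) A t
  exact h.clm_apply (hasDerivAt_const t v) |>.congr_deriv (by simp)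

/-- Grönwall's inequality for `G' ≤ k G`. -/
theorem le_exp_mul_of_deriv_le {G G' : ℝ → ℝ} {k s t : ℝ} (hst : s ≤ t)
    (hG : ∀ x, HasDerivAt G (G' x) x) (h : ∀ x ∈ Set.Icc s t, G' x ≤ k * G x) :
    G t ≤ Real.exp (k * (t - s)) * G s := by
  have hd : ∀ x, HasDerivAt (fun x => Real.exp (-(k * x)) * G x)
      (Real.exp (-(k * x)) * (G' x - k * G x)) x := by
    intro x
    have h1 : HasDerivAt (fun x : ℝ => -(k * x)) (-k) x := by
      simpa using ((hasDerivAt_id x).const_mul k).fun_neg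
    refine (h1.exp.mul (hG x)).congr_deriv ?_
    ring
  have hanti : AntitoneOn (fun x => Real.exp (-(k * x)) * G x) (Set.Icc s t) := by
    refine antitoneOn_of_deriv_nonpos (convex_Icc s t)
      (fun x _ => (hd x).continuousAt.continuousWithinAt)
      (fun x _ => (hd x).differentiableAt.differentiableWithinAt) fun x hx => ?_
    rw [(hd x).deriv]
    have := h x (interior_subset hx)
    exact mul_nonpos_of_nonneg_of_nonpos (Real.exp_pos _).le (by linarith)
  have : Real.exp (-(k * t)) * G t ≤ Real.exp (-(k * s)) * G s :=
    hanti (Set.left_mem_Icc.2 hst) (Set.right_mem_Icc.2 hst) hst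
  calc G t = Real.exp (k * t) * (Real.exp (-(k * t)) * G t) := by
        rw [← mul_assoc, ← Real.exp_add]; simp
    _ ≤ Real.exp (k * t) * (Real.exp (-(k * s)) * G s) := by gcongr
    _ = Real.exp (k * (t - s)) * G s := by
        rw [← mul_assoc, ← Real.exp_add]; congr 2; ring

/-- Grönwall's inequality for `G' ≤ -a G + H`. -/
theorem le_exp_mul_add_of_deriv_le {G G' : ℝ → ℝ} {a H s t : ℝ} (hst : s ≤ t) (ha : 0 < a)
    (hH : 0 ≤ H) (hG : ∀ x, HasDerivAt G (G' x) x)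
    (h : ∀ x ∈ Set.Icc s t, G' x ≤ -a * G x + H) :
    G t ≤ Real.exp (-a * (t - s)) * G s + H / a := by
  -- Subtracting the equilibrium value `H / a` makes the inequality homogeneous.
  have := le_exp_mul_of_deriv_le (G := fun x => G x - H / a) (G' := G') (k := -a) hst
    (fun x => (hG x).sub_const _) (fun x hx => by
      have := h x hx
      have h2 : a * (H / a) = H := by field_simp
      linarith)
  have h3 : 0 ≤ Real.exp (-a * (t - s)) * (H / a) := by positivity
  linarith

/-! ### Square summable functions and Nash's inequality -/

/-- The Hilbert space of square summable functions on `ℤ^d`. -/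
abbrev SqSummable (d : ℕ) : Type := lp (fun _ : Fin d → ℤ => ℝ) 2

namespace SqSummable

variable {d : ℕ}

theorem hasSum_mul (f g : SqSummable d) : HasSum (fun z => f z * g z) (inner ℝ f g) := by
  have := lp.hasSum_inner (𝕜 := ℝ) f g
  simpa [mul_comm] using this

theorem hasSum_sq (f : SqSummable d) : HasSum (fun z => f z ^ 2) (‖f‖ ^ 2) := by
  have := hasSum_mul f f
  rw [real_inner_self_eq_norm_sq] at this
  simpa [sq] using this

theorem memℓp_of_summable_sq {f : (Fin d → ℤ) → ℝ} (hf : Summable fun z => f z ^ 2) :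
    Memℓp f 2 := by
  refine memℓp_gen ?_
  simpa using hf

/-- The bounded operator `f ↦ a(·) f(· + e)`. -/
noncomputable def weightedShift (e : Fin d → ℤ) (a : (Fin d → ℤ) → ℝ) (C : ℝ)
    (ha : ∀ z, |a z| ≤ C) : SqSummable d →L[ℝ] SqSummable d :=
  have hle : ∀ (f : SqSummable d) z, (a z * f (z + e)) ^ 2 ≤ C ^ 2 * f (z + e) ^ 2 :=
    fun f z => by
      rw [mul_pow]
      exact mul_le_mul_of_nonneg_right (sq_le_sq' (abs_le.1 (ha z)).1 (abs_le.1 (ha z)).2)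
        (sq_nonneg _)
  have hs : ∀ f : SqSummable d, HasSum (fun z => C ^ 2 * f (z + e) ^ 2) (C ^ 2 * ‖f‖ ^ 2) :=
    fun f => ((Equiv.addRight e).hasSum_iff.2 (hasSum_sq f)).mul_left _
  have hsum : ∀ f : SqSummable d, Summable fun z => (a z * f (z + e)) ^ 2 := fun f =>
    (hs f).summable.of_nonneg_of_le (fun _ => sq_nonneg _) (hle f)
  LinearMap.mkContinuous
    { toFun := fun f => ⟨fun z => a z * f (z + e), memℓp_of_summable_sq (hsum f)⟩
      map_add' := fun f g => by
        ext z
        exact mul_add _ _ _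
      map_smul' := fun c f => by
        ext z
        exact mul_left_comm _ _ _ } C
    (fun f => by
      have hC : 0 ≤ C := (abs_nonneg _).trans (ha 0)
      refine le_of_sq_le_sq ?_ (by positivity)
      rw [mul_pow]
      exact hasSum_le (hle f) (hasSum_sq _) (hs f))

@[simp]
theorem weightedShift_apply (e : Fin d → ℤ) (a : (Fin d → ℤ) → ℝ) (C : ℝ)
    (ha : ∀ z, |a z| ≤ C) (f : SqSummable d) (z : Fin d → ℤ) :
    weightedShift e a C ha f z = a z * f (z + e) := rfl

/-- Translation by `e`. -/
noncomputable def shift (e : Fin d → ℤ) : SqSummable d →L[ℝ] SqSummable d :=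
  weightedShift e (fun _ => 1) 1 (by simp)

@[simp]
theorem shift_apply (e : Fin d → ℤ) (f : SqSummable d) (z : Fin d → ℤ) :
    shift e f z = f (z + e) := one_mul _

theorem norm_shift (e : Fin d → ℤ) (f : SqSummable d) : ‖shift e f‖ = ‖f‖ := by
  have h := hasSum_sq (shift e f)
  simp only [shift_apply] at h
  have h2 := (Equiv.addRight e).hasSum_iff.2 (hasSum_sq f)
  have := h.unique h2
  exact (sq_eq_sq₀ (norm_nonneg _) (norm_nonneg _)).1 this

/-- Shifts are isometries, so the cost of a translation is subadditive along a lattice path. -/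
theorem norm_shift_add_sub_le (e e' : Fin d → ℤ) (f : SqSummable d) :
    ‖shift (e + e') f - f‖ ≤ ‖shift e f - f‖ + ‖shift e' f - f‖ := by
  have h : shift (e + e') f - f = shift e' (shift e f - f) + (shift e' f - f) := by
    rw [map_sub, sub_add_sub_cancel]
    congr 1
    ext z
    simp only [shift_apply]
    abel_nf
  rw [h]
  exact (norm_add_le _ _).trans_eq (by rw [norm_shift])

theorem shift_zero (f : SqSummable d) : shift 0 f = f := by
  ext z
  simp

theorem norm_shift_nsmul_sub_le (n : ℕ) (e : Fin d → ℤ) (f : SqSummable d) :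
    ‖shift (n • e) f - f‖ ≤ n * ‖shift e f - f‖ := by
  induction n with
  | zero => simp [shift_zero]
  | succ n ih =>
    rw [succ_nsmul]
    refine (norm_shift_add_sub_le _ _ _).trans ?_
    push_cast
    linarith

theorem norm_shift_sub_le (k : Fin d → ℕ) (f : SqSummable d) :
    ‖shift (fun i => (k i : ℤ)) f - f‖ ≤ ∑ i, k i * ‖shift (unitVec i) f - f‖ := by
  have h : (fun i => (k i : ℤ)) = ∑ i, k i • unitVec i := by
    ext j
    rw [Finset.sum_apply, Finset.sum_eq_single j]
    · simp
    · intro i _ hi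
      simp [Pi.single_eq_of_ne hi.symm]
    · simp
  rw [h]
  refine (Finset.le_sum_of_subadditive (fun e => ‖shift e f - f‖) (by simp [shift_zero])
    (fun e e' => norm_shift_add_sub_le e e' f) _ _).trans ?_
  exact Finset.sum_le_sum fun i _ => norm_shift_nsmul_sub_le _ _ _

/-- The Dirichlet form of the simple random walk on `ℤ^d`. -/
noncomputable def dirichlet (f : SqSummable d) : ℝ := ∑ i, ‖shift (unitVec i) f - f‖ ^ 2

/-- A linear form of Nash's inequality on `ℤ^d`, at the scale `r`. -/
theorem norm_sq_le_dirichlet (f : SqSummable d) (hf : Summable fun z => |f z|) {r : ℕ}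
    (hr : 0 < r) :
    ‖f‖ ^ 2 ≤ 2 * d * r ^ 2 * dirichlet f + 2 / r ^ d * (∑' z, |f z|) ^ 2 := by
  set L := ∑' z, |f z| with hL
  have hL0 : 0 ≤ L := tsum_nonneg fun _ => abs_nonneg _
  set h : (Fin d → Fin r) → Fin d → ℤ := fun k i => ((k i : ℕ) : ℤ) with hh
  have hinj : Function.Injective h := by
    intro k l hkl
    ext i
    have := congrFun hkl i
    simpa [hh] using this
  set N : ℝ := (r : ℝ) ^ d with hN
  have hN0 : 0 < N := by positivity
  have hcard : (Finset.univ : Finset (Fin d → Fin r)).card = r ^ d := by simp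
  set S : ℝ := ∑ i, ‖shift (unitVec i) f - f‖
  have hS0 : 0 ≤ S := Finset.sum_nonneg fun _ _ => norm_nonneg _
  set G : SqSummable d := ∑ k, shift (h k) f with hG
  have hGz : ∀ z, G z = ∑ k, f (z + h k) := by
    intro z
    rw [hG, lp.coeFn_sum, Finset.sum_apply]
    simp
  have h1 : ∀ k, ‖shift (h k) f - f‖ ≤ r * S := by
    intro k
    refine (norm_shift_sub_le (fun i => (k i : ℕ)) f).trans ?_
    rw [Finset.mul_sum]
    refine Finset.sum_le_sum fun i _ => mul_le_mul_of_nonneg_right ?_ (norm_nonneg _)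
    exact_mod_cast (k i).2.le
  have h2 : N * ‖f‖ ≤ N * (r * S) + ‖G‖ := by
    -- `f` is its average over a box of side `r` plus the average of its increments; the increments
    -- are controlled by the gradient.
    have e1 : N • f = G - ∑ k, (shift (h k) f - f) := by
      rw [Finset.sum_sub_distrib, Finset.sum_const, hcard, sub_sub_cancel, ← Nat.cast_smul_eq_nsmul ℝ]
      push_cast
      rfl
    have e2 : ‖∑ k, (shift (h k) f - f)‖ ≤ N * (r * S) := by
      refine (norm_sum_le_of_le _ fun k _ => h1 k).trans_eq ?_
      rw [Finset.sum_const, hcard, nsmul_eq_mul]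
      push_cast
      rfl
    calc N * ‖f‖ = ‖N • f‖ := by rw [norm_smul, Real.norm_of_nonneg hN0.le]
      _ ≤ ‖G‖ + ‖∑ k, (shift (h k) f - f)‖ := by rw [e1]; exact norm_sub_le _ _
      _ ≤ _ := by linarith
  have hsupG : ∀ z, |G z| ≤ L := by
    intro z
    rw [hGz]
    refine (Finset.abs_sum_le_sum_abs _ _).trans ?_
    -- Distinct box points hit distinct lattice points, so the box sum never exceeds the full `ℓ¹`
    -- norm.
    have hi : Function.Injective fun k => z + h k := fun k l hkl => hinj (add_right_injective z hkl)
    have := hf.sum_le_tsum (Finset.univ.map ⟨fun k => z + h k, hi⟩) (fun _ _ => abs_nonneg _)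
    simpa using this
  have hsumG : HasSum (fun z => ∑ k, L * |f (z + h k)|) (∑ _k : Fin d → Fin r, L * L) := by
    refine hasSum_sum fun k _ => ?_
    exact ((Equiv.addRight (h k)).hasSum_iff.2 hf.hasSum).mul_left L
  -- `‖G‖₂² ≤ ‖G‖_∞ ‖G‖₁`, with `‖G‖_∞ ≤ L` and `‖G‖₁ ≤ N L`.
  have h3 : ‖G‖ ^ 2 ≤ N * L ^ 2 := by
    refine (hasSum_le (fun z => ?_) (hasSum_sq G) hsumG).trans_eq ?_
    · rw [← sq_abs, sq, ← Finset.mul_sum]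
      refine mul_le_mul (hsupG z) ?_ (abs_nonneg _) hL0
      rw [hGz]
      exact Finset.abs_sum_le_sum_abs _ _
    · rw [Finset.sum_const, hcard, nsmul_eq_mul]
      push_cast
      ring
  have h4 : S ^ 2 ≤ d * dirichlet f := by
    simpa [S, dirichlet] using sq_sum_le_card_mul_sum_sq (s := (Finset.univ : Finset (Fin d)))
      (f := fun i => ‖shift (unitVec i) f - f‖)
  have h5 : N ^ 2 * ‖f‖ ^ 2 ≤ N ^ 2 * (2 * r ^ 2 * S ^ 2 + 2 / N * L ^ 2) := by
    calc N ^ 2 * ‖f‖ ^ 2 = (N * ‖f‖) ^ 2 := by ring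
      _ ≤ (N * (r * S) + ‖G‖) ^ 2 := by gcongr
      _ ≤ 2 * (N * (r * S)) ^ 2 + 2 * ‖G‖ ^ 2 := by nlinarith [sq_nonneg (N * (r * S) - ‖G‖)]
      _ ≤ 2 * (N * (r * S)) ^ 2 + 2 * (N * L ^ 2) := by gcongr
      _ = _ := by field_simp
  have h6 := le_of_mul_le_mul_left h5 (by positivity)
  calc ‖f‖ ^ 2 ≤ 2 * r ^ 2 * S ^ 2 + 2 / N * L ^ 2 := h6
    _ ≤ 2 * r ^ 2 * (d * dirichlet f) + 2 / N * L ^ 2 := by gcongr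
    _ = _ := by ring

end SqSummable

/-! ### Davies' energy estimate for the conjugated generator -/

theorem exp_add_exp_neg_sub_two_le {δ l : ℝ} (hδ : |δ| ≤ l) (hl : l ≤ 1) :
    0 ≤ Real.exp δ + Real.exp (-δ) - 2 ∧ Real.exp δ + Real.exp (-δ) - 2 ≤ 2 * l ^ 2 := by
  have hsq : δ ^ 2 ≤ l ^ 2 := sq_le_sq' (abs_le.1 hδ).1 (abs_le.1 hδ).2
  have hl0 : 0 ≤ l := (abs_nonneg _).trans hδ
  have hsq1 : l ^ 2 ≤ 1 := pow_le_one₀ hl0 hl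
  have h := Real.cosh_eq δ
  constructor
  · linarith [Real.one_le_cosh δ]
  · have h1 := Real.cosh_le_exp_half_sq δ
    have h2 := Real.abs_exp_sub_one_le (x := δ ^ 2 / 2)
      (by rw [abs_of_nonneg (by positivity)]; linarith)
    rw [abs_of_nonneg (a := δ ^ 2 / 2) (by positivity)] at h2
    have := (abs_le.1 h2).2
    linarith

/-- The contribution of one edge to the energy: the two opposite jumps carry the factors `e^δ` and
`e^{-δ}`, so the first-order effect of the tilt cancels and only `2 cosh δ - 2 = O(l²)` remains. -/
theorem edge_energy_le {a b c x y δ l : ℝ} (ha : 1 ≤ a) (ha' : a ≤ c) (hb : 1 ≤ b) (hb' : b ≤ c)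
    (hδ : |δ| ≤ l) (hl : l ≤ 1) :
    a * x * (b * (Real.exp δ * y - x)) + b * y * (a * (Real.exp (-δ) * x - y)) ≤
      -(y - x) ^ 2 + c * l ^ 2 * (a * x ^ 2 + b * y ^ 2) := by
  obtain ⟨h0, h1⟩ := exp_add_exp_neg_sub_two_le hδ hl
  set k := Real.exp δ + Real.exp (-δ) - 2 with hk
  have hab : 1 ≤ a * b := by nlinarith
  have h2 : x * y * k ≤ l ^ 2 * (x ^ 2 + y ^ 2) := by
    have : x * y * k ≤ (x ^ 2 + y ^ 2) / 2 * k :=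
      mul_le_mul_of_nonneg_right (by nlinarith [sq_nonneg (x - y)]) h0
    have : (x ^ 2 + y ^ 2) / 2 * k ≤ (x ^ 2 + y ^ 2) / 2 * (2 * l ^ 2) := by gcongr
    linarith
  have h3 : a * b * (x * y * k) ≤ a * b * (l ^ 2 * (x ^ 2 + y ^ 2)) := by gcongr
  have h4 : (y - x) ^ 2 ≤ a * b * (y - x) ^ 2 := le_mul_of_one_le_left (sq_nonneg _) hab
  have h5 : a * b * (l ^ 2 * x ^ 2) ≤ a * c * (l ^ 2 * x ^ 2) := by gcongr
  have h6 : a * b * (l ^ 2 * y ^ 2) ≤ c * b * (l ^ 2 * y ^ 2) := by gcongr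
  calc a * x * (b * (Real.exp δ * y - x)) + b * y * (a * (Real.exp (-δ) * x - y))
      = a * b * (x * y * k) - a * b * (y - x) ^ 2 := by rw [hk]; ring
    _ ≤ a * b * (l ^ 2 * (x ^ 2 + y ^ 2)) - (y - x) ^ 2 := by linarith
    _ ≤ _ := by linarith

section TiltedGenerator

variable {d : ℕ} {α : (Fin d → ℤ) → ℕ} {c : ℕ} {ψ : (Fin d → ℤ) → ℝ} {l : ℝ}

/-- Multiplication by the reversible measure `α`. -/
noncomputable def envMul (hα : ∀ z, 1 ≤ α z ∧ α z ≤ c) : SqSummable d →L[ℝ] SqSummable d :=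
  SqSummable.weightedShift 0 (fun z => (α z : ℝ)) c
    (fun z => by rw [Nat.abs_cast]; exact_mod_cast (hα z).2)

theorem envMul_apply (hα : ∀ z, 1 ≤ α z ∧ α z ≤ c) (f : SqSummable d) (z : Fin d → ℤ) :
    envMul hα f z = α z * f z := by
  simp [envMul]

/-- The part of the conjugated generator `e^ψ A e^{-ψ}` that comes from the jumps by `e`. -/
noncomputable def tiltedJump (hα : ∀ z, 1 ≤ α z ∧ α z ≤ c) (e : Fin d → ℤ)
    (hψ : ∀ z, |ψ z - ψ (z + e)| ≤ 1) : SqSummable d →L[ℝ] SqSummable d :=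
  SqSummable.weightedShift e (fun z => α (z + e) * Real.exp (ψ z - ψ (z + e))) (c * Real.exp 1)
    (fun z => by
      rw [abs_mul, Nat.abs_cast, Real.abs_exp]
      have h1 : (α (z + e) : ℝ) ≤ c := by exact_mod_cast (hα _).2
      have h2 := (abs_le.1 (hψ z)).2
      gcongr) -
  SqSummable.weightedShift 0 (fun z => (α (z + e) : ℝ)) c
    (fun z => by rw [Nat.abs_cast]; exact_mod_cast (hα _).2)

theorem tiltedJump_apply (hα : ∀ z, 1 ≤ α z ∧ α z ≤ c) (e : Fin d → ℤ)
    (hψ : ∀ z, |ψ z - ψ (z + e)| ≤ 1) (f : SqSummable d) (z : Fin d → ℤ) :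
    tiltedJump hα e hψ f z =
      α (z + e) * (Real.exp (ψ z - ψ (z + e)) * f (z + e) - f z) := by
  rw [tiltedJump, sub_apply, lp.coeFn_sub, Pi.sub_apply, SqSummable.weightedShift_apply,
    SqSummable.weightedShift_apply, add_zero]
  ring

theorem tilt_neg (hψ : ∀ z i, |ψ z - ψ (z + unitVec i)| ≤ l) (z : Fin d → ℤ) (i : Fin d) :
    |ψ z - ψ (z + -unitVec i)| ≤ l := by
  have := hψ (z + -unitVec i) i
  rwa [neg_add_cancel_right, abs_sub_comm] at this

/-- The conjugated generator `e^ψ A e^{-ψ}` on square summable functions. -/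
noncomputable def tiltedGenerator (hα : ∀ z, 1 ≤ α z ∧ α z ≤ c)
    (hψ : ∀ z i, |ψ z - ψ (z + unitVec i)| ≤ l) (hl : l ≤ 1) :
    SqSummable d →L[ℝ] SqSummable d :=
  ∑ i, (tiltedJump hα (unitVec i) (fun z => (hψ z i).trans hl) +
    tiltedJump hα (-unitVec i) (fun z => (tilt_neg hψ z i).trans hl))

theorem exp_neg_mul_tiltedGenerator (hα : ∀ z, 1 ≤ α z ∧ α z ≤ c)
    (hψ : ∀ z i, |ψ z - ψ (z + unitVec i)| ≤ l) (hl : l ≤ 1) (f : SqSummable d)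
    (z : Fin d → ℤ) :
    Real.exp (-ψ z) * tiltedGenerator hα hψ hl f z =
      rwGenerator α (fun w => Real.exp (-ψ w) * f w) z := by
  have hj : ∀ (e : Fin d → ℤ) (he : ∀ z, |ψ z - ψ (z + e)| ≤ 1),
      Real.exp (-ψ z) * tiltedJump hα e he f z = α (z + e) *
        (Real.exp (-ψ (z + e)) * f (z + e) - Real.exp (-ψ z) * f z) := by
    intro e he
    have : Real.exp (-ψ (z + e)) = Real.exp (-ψ z) * Real.exp (ψ z - ψ (z + e)) := by
      rw [← Real.exp_add]
      congr 1
      ring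
    rw [tiltedJump_apply, this]
    ring
  rw [rwGenerator_eq, tiltedGenerator, sum_apply, lp.coeFn_sum,
    Finset.sum_apply, Finset.mul_sum]
  refine Finset.sum_congr rfl fun i _ => ?_
  rw [add_apply, lp.coeFn_add, Pi.add_apply, mul_add, hj, hj]
  simp only [sub_eq_add_neg]

theorem inner_envMul_comm (hα : ∀ z, 1 ≤ α z ∧ α z ≤ c) (f g : SqSummable d) :
    inner ℝ (envMul hα f) g = inner ℝ f (envMul hα g) := by
  refine (SqSummable.hasSum_mul _ _).unique ?_
  convert SqSummable.hasSum_mul f (envMul hα g) using 2 with z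
  rw [envMul_apply, envMul_apply]
  ring

theorem hasSum_envMul_sq (hα : ∀ z, 1 ≤ α z ∧ α z ≤ c) (f : SqSummable d) :
    HasSum (fun z => α z * f z ^ 2) (inner ℝ (envMul hα f) f) := by
  convert SqSummable.hasSum_mul (envMul hα f) f using 2 with z
  rw [envMul_apply]
  ring

theorem inner_envMul_le_norm_sq (hα : ∀ z, 1 ≤ α z ∧ α z ≤ c) (f : SqSummable d) :
    inner ℝ (envMul hα f) f ≤ c * ‖f‖ ^ 2 := by
  refine hasSum_le (fun z => ?_) (hasSum_envMul_sq hα f)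
    ((SqSummable.hasSum_sq f).mul_left (c : ℝ))
  exact mul_le_mul_of_nonneg_right (by exact_mod_cast (hα z).2) (sq_nonneg _)

/-- The energy estimate in one coordinate direction. -/
theorem inner_tiltedJump_add_le (hα : ∀ z, 1 ≤ α z ∧ α z ≤ c) (e : Fin d → ℤ)
    (hψ : ∀ z, |ψ z - ψ (z + e)| ≤ l) (hl : l ≤ 1) (h₁ : ∀ z, |ψ z - ψ (z + e)| ≤ 1)
    (h₂ : ∀ z, |ψ z - ψ (z + -e)| ≤ 1) (f : SqSummable d) :
    inner ℝ (envMul hα f) (tiltedJump hα e h₁ f) +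
      inner ℝ (envMul hα f) (tiltedJump hα (-e) h₂ f) ≤
      -‖SqSummable.shift e f - f‖ ^ 2 + 2 * c * l ^ 2 * inner ℝ (envMul hα f) f := by
  have s1 := SqSummable.hasSum_mul (envMul hα f) (tiltedJump hα e h₁ f)
  -- Reindexing by `e` pairs each jump with its reverse across the same edge.
  have s2 := (Equiv.addRight e).hasSum_iff.2
    (SqSummable.hasSum_mul (envMul hα f) (tiltedJump hα (-e) h₂ f))
  have s3 := SqSummable.hasSum_sq (SqSummable.shift e f - f)
  have s4 := hasSum_envMul_sq hα f
  have s5 := (Equiv.addRight e).hasSum_iff.2 s4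
  have h := hasSum_le (fun z => ?_) (s1.add s2) (s3.neg.add ((s4.add s5).mul_left (c * l ^ 2)))
  · linarith
  · simp only [Function.comp_apply, Equiv.coe_addRight, envMul_apply, tiltedJump_apply,
      lp.coeFn_sub, Pi.sub_apply, SqSummable.shift_apply, add_neg_cancel_right]
    have h := edge_energy_le (a := α z) (b := α (z + e)) (c := c) (x := f z) (y := f (z + e))
      (by exact_mod_cast (hα z).1) (by exact_mod_cast (hα z).2)
      (by exact_mod_cast (hα (z + e)).1) (by exact_mod_cast (hα (z + e)).2) (hψ z) hl
    rwa [neg_sub] at h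

/-- Davies' energy estimate for the conjugated generator. -/
theorem inner_tiltedGenerator_le (hα : ∀ z, 1 ≤ α z ∧ α z ≤ c)
    (hψ : ∀ z i, |ψ z - ψ (z + unitVec i)| ≤ l) (hl : l ≤ 1) (f : SqSummable d) :
    inner ℝ (envMul hα f) (tiltedGenerator hα hψ hl f) ≤
      -f.dirichlet + 2 * d * c * l ^ 2 * inner ℝ (envMul hα f) f := by
  rw [tiltedGenerator, sum_apply, inner_sum, SqSummable.dirichlet]
  calc _ ≤ ∑ i : Fin d, (-‖SqSummable.shift (unitVec i) f - f‖ ^ 2 +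
        2 * c * l ^ 2 * inner ℝ (envMul hα f) f) := by
        refine Finset.sum_le_sum fun i _ => ?_
        rw [add_apply, inner_add_right]
        exact inner_tiltedJump_add_le hα _ (fun z => hψ z i) hl _ _ f
    _ = _ := by
      rw [Finset.sum_add_distrib, Finset.sum_neg_distrib]
      simp
      ring

end TiltedGenerator

/-! ### The transition semigroup: continuity, Kolmogorov equations, reversibility -/

theorem hasDerivWithinAt_of_tendsto_nnreal {g : ℝ≥0 → ℝ} {L : ℝ} {t : ℝ≥0}
    (h : Tendsto (fun s : ℝ≥0 => (g (t + s) - g t) / (s : ℝ)) (𝓝[>] 0) (𝓝 L)) :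
    HasDerivWithinAt (fun s : ℝ => g s.toNNReal) L (Set.Ici (t : ℝ)) t := by
  rw [← hasDerivWithinAt_Ioi_iff_Ici, hasDerivWithinAt_iff_tendsto_slope' (by simp)]
  have hlim : Tendsto (fun s : ℝ => (s - t).toNNReal) (𝓝[>] (t : ℝ)) (𝓝[>] 0) := by
    refine tendsto_nhdsWithin_iff.2 ⟨?_, ?_⟩
    · have hc : Continuous fun s : ℝ => (s - t).toNNReal := by fun_prop
      have := hc.tendsto (t : ℝ)
      simp only [sub_self, Real.toNNReal_zero] at this
      exact this.mono_left nhdsWithin_le_nhds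
    · filter_upwards [self_mem_nhdsWithin] with s hs
      exact Real.toNNReal_pos.2 (sub_pos.2 hs)
  refine (h.comp hlim).congr' ?_
  filter_upwards [self_mem_nhdsWithin] with s hs
  have hs' : (t : ℝ) < s := hs
  have h1 : t + (s - t).toNNReal = s.toNNReal := by
    ext
    rw [NNReal.coe_add, Real.coe_toNNReal _ (by linarith), Real.coe_toNNReal _ (by
      linarith [t.coe_nonneg])]
    ring
  rw [Function.comp_apply, h1, slope_def_field, Real.coe_toNNReal _ (by linarith),
    Real.toNNReal_coe]

/-- A forward increment bound that is uniform in the base point also controls backward increments,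
hence gives two-sided continuity. -/
theorem continuous_of_local_growth {g : ℝ≥0 → ℝ} {K : ℝ} {δ : ℝ≥0} (hδ : 0 < δ)
    (h : ∀ s, s < δ → ∀ t, |g (t + s) - g t| ≤ K * s) : Continuous g := by
  have hK : 0 ≤ K := by
    have h1 := (abs_nonneg _).trans (h (δ / 2) (half_lt_self hδ) 0)
    have h2 : (0 : ℝ) < ((δ / 2 : ℝ≥0) : ℝ) := by exact_mod_cast half_pos hδ
    exact nonneg_of_mul_nonneg_left h1 h2
  have key : ∀ s t : ℝ≥0, s ≤ t → dist s t < δ → |g t - g s| ≤ K * dist s t := by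
    intro s t hst hd
    have he : s + (t - s) = t := add_tsub_cancel_of_le hst
    have hc : ((t - s : ℝ≥0) : ℝ) = dist s t := by
      rw [NNReal.coe_sub hst, NNReal.dist_eq, abs_sub_comm, abs_of_nonneg]
      exact sub_nonneg.2 hst
    have := h (t - s) (by rw [← NNReal.coe_lt_coe, hc]; exact hd) s
    rwa [he, hc] at this
  rw [Metric.continuous_iff]
  intro t ε hε
  refine ⟨min δ (ε / (K + 1)), by positivity, fun s hs => ?_⟩
  have hd1 : dist s t < δ := hs.trans_le (min_le_left _ _)
  have hd2 : dist s t < ε / (K + 1) := hs.trans_le (min_le_right _ _)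
  have hle : |g s - g t| ≤ K * dist s t := by
    rcases le_total s t with hst | hst
    · rw [abs_sub_comm]; exact key s t hst hd1
    · rw [dist_comm]; exact key t s hst (by rwa [dist_comm])
  rw [Real.dist_eq]
  refine hle.trans_lt ?_
  rw [lt_div_iff₀ (by linarith)] at hd2
  nlinarith [dist_nonneg (x := s) (y := t)]

section Semigroup

variable {d : ℕ} {α : (Fin d → ℤ) → ℕ} {c : ℕ}
  {κ : ℝ≥0 → Kernel (Fin d → ℤ) (Fin d → ℤ)}

theorem integrable_of_abs_le {E : Type*} [MeasurableSpace E] [DiscreteMeasurableSpace E]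
    (μ : Measure E) [IsFiniteMeasure μ] {f : E → ℝ} {C : ℝ} (hf : ∀ z, |f z| ≤ C) :
    Integrable f μ :=
  Integrable.of_bound Measurable.of_discrete.aestronglyMeasurable C (ae_of_all _ hf)

theorem hasSum_measureReal_singleton_mul {E : Type*} [MeasurableSpace E]
    [Countable E] [MeasurableSingletonClass E]
    (μ : Measure E) [IsProbabilityMeasure μ] {f : E → ℝ} {C : ℝ} (hf : ∀ z, |f z| ≤ C) :
    HasSum (fun z => μ.real {z} * f z) (∫ z, f z ∂μ) := by
  have hs1 : Summable fun z => μ.real {z} := by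
    refine summable_of_sum_le (c := 1) (fun _ => measureReal_nonneg) fun s => ?_
    rw [sum_measureReal_singleton]
    exact measureReal_le_one
  have hs : Summable fun z => μ.real {z} * f z := by
    refine (hs1.mul_right C).of_norm_bounded fun z => ?_
    rw [norm_mul, Real.norm_of_nonneg measureReal_nonneg]
    exact mul_le_mul_of_nonneg_left (hf z) measureReal_nonneg
  rw [integral_countable (integrable_of_abs_le μ hf)]
  exact hs.hasSum

theorem IsMarkovSemigroup.real_le_one
    (hκ : IsMarkovSemigroup κ) (t : ℝ≥0) (x y : Fin d → ℤ) : (κ t x).real {y} ≤ 1 := by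
  have := hκ.markov t
  exact measureReal_le_one

theorem IsMarkovSemigroup.abs_real_le_one
    (hκ : IsMarkovSemigroup κ) (t : ℝ≥0) (x y : Fin d → ℤ) :
    |(κ t x).real {y}| ≤ 1 := by
  rw [abs_of_nonneg measureReal_nonneg]
  exact hκ.real_le_one t x y

theorem IsMarkovSemigroup.real_zero
    (hκ : IsMarkovSemigroup κ) (x y : Fin d → ℤ) :
    (κ 0 x).real {y} = Set.indicator {y} 1 x := by
  rw [hκ.zero, Kernel.id_apply, measureReal_def, Measure.dirac_apply]
  by_cases h : x ∈ ({y} : Set (Fin d → ℤ)) <;> simp [h]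

theorem IsMarkovSemigroup.hasSum_real
    (hκ : IsMarkovSemigroup κ) (t : ℝ≥0) (x : Fin d → ℤ) :
    HasSum (fun y => (κ t x).real {y}) 1 := by
  have := hκ.markov t
  simpa using hasSum_measureReal_singleton_mul (κ t x) (f := fun _ => 1) (C := 1) (by simp)

theorem IsMarkovSemigroup.integral_real
    (hκ : IsMarkovSemigroup κ) (s t : ℝ≥0) (x y : Fin d → ℤ) :
    ∫ z, (κ t z).real {y} ∂(κ s x) = (κ (s + t) x).real {y} := by
  have := hκ.markov t
  have := hκ.markov s
  have h := Kernel.integral_comp (κ := κ s) (η := κ t) (a := x)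
    (f := Set.indicator {y} (1 : (Fin d → ℤ) → ℝ))
    (integrable_of_abs_le _ (C := 1) fun z => by
      by_cases hz : z ∈ ({y} : Set (Fin d → ℤ)) <;> simp [hz])
  simp only [integral_indicator_one (MeasurableSet.singleton y)] at h
  rw [hκ.add, h]

theorem IsMarkovSemigroup.hasSum_real_mul
    (hκ : IsMarkovSemigroup κ) (s t : ℝ≥0) (x y : Fin d → ℤ) :
    HasSum (fun z => (κ s x).real {z} * (κ t z).real {y}) ((κ (s + t) x).real {y}) := by
  have := hκ.markov s
  rw [← hκ.integral_real]
  exact hasSum_measureReal_singleton_mul (κ s x) fun z => hκ.abs_real_le_one t z y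

theorem abs_indicator_one_le {E : Type*} (s : Set E) (z : E) :
    |s.indicator (1 : E → ℝ) z| ≤ 1 := by
  by_cases hz : z ∈ s <;> simp [hz]

theorem HasGenerator.tendstoUniformly_real
    (hgen : HasGenerator κ (rwGenerator α)) (y : Fin d → ℤ) :
    TendstoUniformly (fun (t : ℝ≥0) x =>
      ((κ t x).real {y} - Set.indicator {y} 1 x) / (t : ℝ))
      (rwGenerator α (Set.indicator {y} 1)) (𝓝[>] 0) := by
  have h := hgen (Set.indicator {y} 1) Measurable.of_discrete ⟨1, abs_indicator_one_le _⟩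
  simpa only [integral_indicator_one (MeasurableSet.singleton y)] using h

theorem IsMarkovSemigroup.real_add_sub
    (hκ : IsMarkovSemigroup κ) (s t : ℝ≥0) (x y : Fin d → ℤ) :
    (κ (t + s) x).real {y} - (κ t x).real {y} =
      ∫ z, ((κ s z).real {y} - Set.indicator {y} 1 z) ∂(κ t x) := by
  have := hκ.markov t
  rw [integral_sub (integrable_of_abs_le _ fun z => hκ.abs_real_le_one s z y)
    (integrable_of_abs_le _ (abs_indicator_one_le _)), hκ.integral_real,
    integral_indicator_one (MeasurableSet.singleton y)]

theorem IsMarkovSemigroup.continuous_real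
    (hκ : IsMarkovSemigroup κ) (hgen : HasGenerator κ (rwGenerator α)) (hα : ∀ z, α z ≤ c) (x y : Fin d → ℤ) :
    Continuous fun t => (κ t x).real {y} := by
  have h := Metric.tendstoUniformly_iff.1 (hgen.tendstoUniformly_real y) 1 one_pos
  rw [eventually_nhdsWithin_iff] at h
  obtain ⟨δ, hδ, hball⟩ := Metric.eventually_nhds_iff.1 h
  set K : ℝ := 4 * d * c * 1 + 1
  refine continuous_of_local_growth (K := K) (δ := δ.toNNReal) (Real.toNNReal_pos.2 hδ)
    fun s hs t => ?_
  have hK : 0 ≤ K := by positivity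
  -- Uniform convergence to the generator, with error `1`, makes the increment over a short time
  -- linear in `s` uniformly in `z`; integration against `κ t x` preserves this.
  have hbound : ∀ z, |(κ s z).real {y} - Set.indicator {y} 1 z| ≤ K * s := by
    intro z
    rcases eq_or_lt_of_le (zero_le (a := s)) with rfl | hs0
    · rw [hκ.real_zero]; simp
    · have h1 := hball (y := s) (by
        rw [NNReal.dist_eq, NNReal.coe_zero, sub_zero, abs_of_nonneg s.coe_nonneg]
        exact Real.lt_toNNReal_iff_coe_lt.1 hs) hs0 z
      rw [Real.dist_eq, abs_sub_comm] at h1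
      have h2 := abs_rwGenerator_le hα (abs_indicator_one_le {y}) z
      have h3 := abs_sub_abs_le_abs_sub (((κ s z).real {y} - Set.indicator {y} 1 z) / (s : ℝ))
        (rwGenerator α (Set.indicator {y} 1) z)
      have hs0' : (0 : ℝ) < s := hs0
      have h4 : |((κ s z).real {y} - Set.indicator {y} 1 z) / (s : ℝ)| ≤ K := by
        linarith
      rwa [abs_div, abs_of_pos hs0', div_le_iff₀ hs0'] at h4
  have := hκ.markov t
  rw [hκ.real_add_sub]
  refine (norm_integral_le_of_norm_le_const (G := ℝ) (μ := κ t x) (C := K * s)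
    (f := fun z => (κ s z).real {y} - Set.indicator {y} 1 z) (ae_of_all _ hbound)).trans_eq ?_
  simp

/-- The backward equation. -/
theorem IsMarkovSemigroup.hasDerivWithinAt_backward
    (hκ : IsMarkovSemigroup κ) (hgen : HasGenerator κ (rwGenerator α)) (t : ℝ≥0) (x y : Fin d → ℤ) :
    HasDerivWithinAt (fun s : ℝ => (κ s.toNNReal x).real {y})
      (rwGenerator α (fun z => (κ t z).real {y}) x) (Set.Ici (t : ℝ)) t := by
  refine hasDerivWithinAt_of_tendsto_nnreal (g := fun s => (κ s x).real {y}) ?_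
  have h := (hgen (fun z => (κ t z).real {y}) Measurable.of_discrete
    ⟨1, fun z => hκ.abs_real_le_one t z y⟩).tendsto_at x
  refine h.congr fun s => ?_
  rw [hκ.integral_real, add_comm]

/-- The forward equation, in integrated form. -/
theorem IsMarkovSemigroup.hasDerivWithinAt_forward_integral
    (hκ : IsMarkovSemigroup κ) (hgen : HasGenerator κ (rwGenerator α)) (hα : ∀ z, α z ≤ c) (t : ℝ≥0)
    (x y : Fin d → ℤ) :
    HasDerivWithinAt (fun s : ℝ => (κ s.toNNReal x).real {y})
      (∫ z, rwGenerator α (Set.indicator {y} 1) z ∂(κ t x)) (Set.Ici (t : ℝ)) t := by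
  refine hasDerivWithinAt_of_tendsto_nnreal (g := fun s => (κ s x).real {y}) ?_
  have := hκ.markov t
  rw [Metric.tendsto_nhds]
  intro ε hε
  -- Convergence in supremum norm is what allows the limit to pass under the integral.
  filter_upwards [Metric.tendstoUniformly_iff.1 (hgen.tendstoUniformly_real y) (ε / 2)
    (half_pos hε)] with s hs
  have hi1 : Integrable (fun z => ((κ s z).real {y} - Set.indicator {y} 1 z) / (s : ℝ))
      (κ t x) := by
    refine ((integrable_of_abs_le _ fun z => hκ.abs_real_le_one s z y).sub
      (integrable_of_abs_le _ (abs_indicator_one_le _))).div_const _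
  have hi2 : Integrable (rwGenerator α (Set.indicator {y} 1)) (κ t x) :=
    integrable_of_abs_le _ (abs_rwGenerator_le hα (abs_indicator_one_le _))
  rw [hκ.real_add_sub, ← integral_div, Real.dist_eq, ← integral_sub hi1 hi2]
  refine (norm_integral_le_of_norm_le_const (G := ℝ) (μ := κ t x) (C := ε / 2)
    (ae_of_all _ fun z => ?_)).trans_lt ?_
  · have := hs z
    rw [dist_comm, Real.dist_eq] at this
    exact this.le
  · simpa using half_lt_self hε

theorem IsMarkovSemigroup.integral_rwGenerator_indicator
    (hκ : IsMarkovSemigroup κ) (t : ℝ≥0) (x y : Fin d → ℤ) :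
    ∫ z, rwGenerator α (Set.indicator {y} 1) z ∂(κ t x) =
      ∑ i, ((α y * (κ t x).real {y - unitVec i} - α (y + unitVec i) * (κ t x).real {y}) +
        (α y * (κ t x).real {y + unitVec i} - α (y - unitVec i) * (κ t x).real {y})) := by
  classical
  have := hκ.markov t
  have hpt : ∀ z, rwGenerator α (Set.indicator {y} 1) z = ∑ i,
      (((α y : ℝ) * Set.indicator {y - unitVec i} 1 z - α (y + unitVec i) * Set.indicator {y} 1 z) +
      (α y * Set.indicator {y + unitVec i} 1 z - α (y - unitVec i) * Set.indicator {y} 1 z)) := by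
    intro z
    rw [rwGenerator_eq]
    refine Finset.sum_congr rfl fun i _ => ?_
    simp only [Set.indicator_apply, Set.mem_singleton_iff, Pi.one_apply]
    have e1 : z + unitVec i = y ↔ z = y - unitVec i := eq_sub_iff_add_eq.symm
    have e2 : z - unitVec i = y ↔ z = y + unitVec i := sub_eq_iff_eq_add
    rw [if_congr e1 rfl rfl, if_congr e2 rfl rfl, mul_sub, mul_sub]
    congr 2
    · by_cases h : z = y - unitVec i
      · simp [h]
      · simp [h]
    · by_cases h : z = y
      · simp [h]
      · simp [h]
    · by_cases h : z = y + unitVec i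
      · simp [h]
      · simp [h]
    · by_cases h : z = y
      · simp [h]
      · simp [h]
  have hint : ∀ (a : ℝ) (w : Fin d → ℤ),
      Integrable (fun z => a * Set.indicator {w} (1 : (Fin d → ℤ) → ℝ) z) (κ t x) := fun a w =>
    (integrable_of_abs_le _ (abs_indicator_one_le _)).const_mul a
  have hint2 : ∀ (a b : ℝ) (w w' : Fin d → ℤ), Integrable (fun z =>
      a * Set.indicator {w} (1 : (Fin d → ℤ) → ℝ) z - b * Set.indicator {w'} 1 z) (κ t x) :=
    fun a b w w' => (hint a w).sub (hint b w')
  simp_rw [hpt]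
  refine (integral_finsetSum _ fun i _ => (hint2 _ _ _ _).add (hint2 _ _ _ _)).trans ?_
  refine Finset.sum_congr rfl fun i _ => ?_
  refine (integral_add (hint2 _ _ _ _) (hint2 _ _ _ _)).trans ?_
  rw [integral_sub (hint _ _) (hint _ _), integral_sub (hint _ _) (hint _ _)]
  simp only [integral_const_mul, integral_indicator_one (MeasurableSet.singleton _)]

/-- The walk is reversible with respect to `α`. -/
theorem IsMarkovSemigroup.real_symm
    (hκ : IsMarkovSemigroup κ) (hgen : HasGenerator κ (rwGenerator α)) (hα : ∀ z, 1 ≤ α z ∧ α z ≤ c) (t : ℝ≥0)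
    (x y : Fin d → ℤ) : (κ t x).real {y} = α y / α x * (κ t y).real {x} := by
  have hpos : ∀ z, (0 : ℝ) < α z := fun z => by exact_mod_cast (hα z).1
  have h1 : ∀ z, (1 : ℝ) ≤ α z := fun z => by exact_mod_cast (hα z).1
  have hc : (1 : ℝ) ≤ c := by exact_mod_cast (hα x).1.trans (hα x).2
  have hαc := fun z => (hα z).2
  -- Both sides, as functions of the starting point `x`, solve the backward equation: the right side
  -- does so because the factor `1 / α z` turns the forward equation into the backward one.
  have h := heat_unique hαc (u := fun t z => (κ t.toNNReal z).real {y})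
    (v := fun t z => α y / α z * (κ t.toNNReal y).real {z}) (T := t) (M := c) ?_ ?_ ?_ ?_ ?_ ?_ ?_
    t ⟨t.coe_nonneg, le_rfl⟩ x
  · simpa using h
  · exact fun s _ z => (hκ.abs_real_le_one _ z y).trans hc
  · intro s _ z
    rw [abs_mul, abs_of_pos (div_pos (hpos y) (hpos z))]
    have h2 : (α y : ℝ) / α z ≤ c := by
      rw [div_le_iff₀ (hpos z)]
      have : (α y : ℝ) ≤ c := by exact_mod_cast hαc y
      nlinarith [h1 z]
    calc _ ≤ (c : ℝ) * 1 := by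
          gcongr
          exact hκ.abs_real_le_one _ _ _
      _ = c := mul_one _
  · intro z
    simp only [Real.toNNReal_zero, hκ.real_zero]
    by_cases hz : z = y
    · subst hz
      have := (hpos z).ne'
      simp [this]
    · simp [hz, Ne.symm hz]
  · exact fun z => ((hκ.continuous_real hgen hαc z y).comp continuous_real_toNNReal).continuousOn
  · exact fun z => (continuous_const.mul
      ((hκ.continuous_real hgen hαc y z).comp continuous_real_toNNReal)).continuousOn
  · intro s hs z
    have := hκ.hasDerivWithinAt_backward hgen s.toNNReal z y
    rwa [Real.coe_toNNReal _ hs.1] at this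
  · intro s hs z
    have := hκ.hasDerivWithinAt_forward_integral hgen hαc s.toNNReal y z
    rw [Real.coe_toNNReal _ hs.1, hκ.integral_rwGenerator_indicator] at this
    refine (this.const_mul ((α y : ℝ) / α z)).congr_deriv ?_
    rw [rwGenerator_eq, Finset.mul_sum]
    refine Finset.sum_congr rfl fun i _ => ?_
    have h3 := (hpos z).ne'
    have h4 := (hpos (z + unitVec i)).ne'
    have h5 := (hpos (z - unitVec i)).ne'
    field_simp
    ring

end Semigroup

/-! ### The weighted energy of the heat kernel -/

/-- The Cauchy–Schwarz inequality for series. -/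
theorem summable_and_sq_tsum_le {ι : Type*} {h a b : ι → ℝ} {A B : ℝ} (hh : ∀ i, 0 ≤ h i)
    (ha0 : ∀ i, 0 ≤ a i) (hb0 : ∀ i, 0 ≤ b i) (hab : ∀ i, h i ^ 2 = a i * b i)
    (ha : HasSum a A) (hb : HasSum b B) : Summable h ∧ (∑' i, h i) ^ 2 ≤ A * B := by
  have hA : 0 ≤ A := ha.nonneg ha0
  have hB : 0 ≤ B := hb.nonneg hb0
  have hfin : ∀ s : Finset ι, ∑ i ∈ s, h i ≤ √(A * B) := by
    intro s
    refine Real.le_sqrt_of_sq_le ?_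
    refine (Finset.sum_sq_le_sum_mul_sum_of_sq_le_mul s (fun i _ => ha0 i) (fun i _ => hb0 i)
      fun i _ => (hab i).le).trans ?_
    exact mul_le_mul (sum_le_hasSum s (fun i _ => ha0 i) ha)
      (sum_le_hasSum s (fun i _ => hb0 i) hb) (Finset.sum_nonneg fun i _ => hb0 i) hA
  have hs : Summable h := summable_of_sum_le hh hfin
  refine ⟨hs, ?_⟩
  calc (∑' i, h i) ^ 2 ≤ √(A * B) ^ 2 := by
        gcongr
        · exact tsum_nonneg hh
        · exact hs.tsum_le_of_sum_le hfin
    _ = A * B := Real.sq_sqrt (by positivity)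

theorem SqSummable.hasDerivAt_apply {d : ℕ} {f : ℝ → SqSummable d} {f' : SqSummable d} {t : ℝ}
    (hf : HasDerivAt f f' t) (z : Fin d → ℤ) : HasDerivAt (fun s => f s z) (f' z) t := by
  exact (lp.evalCLM ℝ (fun _ : Fin d → ℤ => ℝ) 2 z).hasFDerivAt.comp_hasDerivAt t hf

theorem abs_l1Norm_weight_sub_le {d : ℕ} {l : ℝ} (hl : 0 ≤ l) (y z : Fin d → ℤ) (i : Fin d) :
    |l * l1Norm (z - y) - l * l1Norm (z + unitVec i - y)| ≤ l := by
  rw [← mul_sub, abs_mul, abs_of_nonneg hl, abs_sub_comm, add_sub_right_comm]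
  exact mul_le_of_le_one_right hl (abs_l1Norm_add_unitVec_sub _ _)

section WeightedEnergy

variable {d : ℕ} {α : (Fin d → ℤ) → ℕ} {c : ℕ}
  {κ : ℝ≥0 → Kernel (Fin d → ℤ) (Fin d → ℤ)}

/-- The heat kernel with target `y`, multiplied by an exponential weight centred at `y`, solves
the conjugated heat equation in `ℓ²`. -/
theorem IsMarkovSemigroup.exists_weighted_solution (hκ : IsMarkovSemigroup κ)
    (hgen : HasGenerator κ (rwGenerator α)) (hα : ∀ z, 1 ≤ α z ∧ α z ≤ c) (y : Fin d → ℤ)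
    {l : ℝ} (hl0 : 0 ≤ l) (hl : l ≤ 1) :
    ∃ f : ℝ → SqSummable d,
      (∀ t, HasDerivAt f (tiltedGenerator hα (abs_l1Norm_weight_sub_le hl0 y) hl (f t)) t) ∧
      ∀ (t : ℝ≥0) z, f t z = Real.exp (l * l1Norm (z - y)) * (κ t z).real {y} := by
  classical
  -- The weight equals `1` at `y`, so the weighted kernel starts from the unit mass at `y`.
  obtain ⟨f, hf0, hf⟩ := exists_linear_ode_solution
    (tiltedGenerator hα (abs_l1Norm_weight_sub_le hl0 y) hl) (lp.single 2 y 1)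
  refine ⟨f, hf, fun t z => ?_⟩
  have hcont : Continuous f := continuous_iff_continuousAt.2 fun s => (hf s).continuousAt
  obtain ⟨M, hM⟩ := (isCompact_Icc (a := (0 : ℝ)) (b := t)).exists_bound_of_continuousOn
    hcont.continuousOn
  have hαc := fun z => (hα z).2
  have hd : ∀ s w, HasDerivAt (fun s => Real.exp (-(l * l1Norm (w - y))) * f s w)
      (rwGenerator α (fun w => Real.exp (-(l * l1Norm (w - y))) * f s w) w) s := by
    intro s w
    rw [← exp_neg_mul_tiltedGenerator hα (abs_l1Norm_weight_sub_le hl0 y) hl]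
    exact (SqSummable.hasDerivAt_apply (hf s) w).const_mul _
  have key := heat_unique hαc (u := fun s w => Real.exp (-(l * l1Norm (w - y))) * f s w)
    (v := fun s w => (κ s.toNNReal w).real {y}) (T := t) (M := max M 1) ?_ ?_ ?_ ?_ ?_ ?_ ?_
    t ⟨t.coe_nonneg, le_rfl⟩ z
  · simp only [Real.toNNReal_coe] at key
    rw [← key, ← mul_assoc, ← Real.exp_add]
    simp
  · intro s hs w
    rw [abs_mul, Real.abs_exp]
    have h1 : |f s w| ≤ M := (lp.norm_apply_le_norm two_ne_zero (f s) w).trans (hM s hs)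
    have h2 : Real.exp (-(l * l1Norm (w - y))) ≤ 1 :=
      Real.exp_le_one_iff.2 (neg_nonpos.2 (mul_nonneg hl0 (l1Norm_nonneg _)))
    exact ((mul_le_of_le_one_left (abs_nonneg _) h2).trans h1).trans (le_max_left _ _)
  · exact fun s _ w => (hκ.abs_real_le_one _ w y).trans (le_max_right _ _)
  · intro w
    simp only [Real.toNNReal_zero, hκ.real_zero, hf0]
    by_cases hw : w = y
    · subst hw
      simp [l1Norm_zero]
    · simp [hw]
  · exact fun w s _ => (hd s w).continuousAt.continuousWithinAt
  · exact fun w => ((hκ.continuous_real hgen hαc w y).comp continuous_real_toNNReal).continuousOn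
  · exact fun s _ w => (hd s w).hasDerivWithinAt
  · intro s hs w
    have := hκ.hasDerivWithinAt_backward hgen s.toNNReal w y
    rwa [Real.coe_toNNReal _ hs.1] at this

/-- The weighted `ℓ²(α)` norm of the heat kernel with target `y`. -/
noncomputable def weightedEnergy (κ : ℝ≥0 → Kernel (Fin d → ℤ) (Fin d → ℤ))
    (α : (Fin d → ℤ) → ℕ) (y : Fin d → ℤ) (l : ℝ) (t : ℝ≥0) : ℝ :=
  ∑' z, α z * (Real.exp (l * l1Norm (z - y)) * (κ t z).real {y}) ^ 2

theorem weightedEnergy_nonneg (y : Fin d → ℤ) (l : ℝ) (t : ℝ≥0) :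
    0 ≤ weightedEnergy κ α y l t :=
  tsum_nonneg fun _ => by positivity

/-- Finiteness of the weighted energy comes from the `ℓ²` solution; it makes the defining `tsum`
meaningful. -/
theorem IsMarkovSemigroup.hasSum_weightedEnergy (hκ : IsMarkovSemigroup κ)
    (hgen : HasGenerator κ (rwGenerator α)) (hα : ∀ z, 1 ≤ α z ∧ α z ≤ c) (y : Fin d → ℤ)
    {l : ℝ} (hl0 : 0 ≤ l) (hl : l ≤ 1) (t : ℝ≥0) :
    HasSum (fun z => α z * (Real.exp (l * l1Norm (z - y)) * (κ t z).real {y}) ^ 2)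
      (weightedEnergy κ α y l t) := by
  obtain ⟨f, -, hf⟩ := hκ.exists_weighted_solution hgen hα y hl0 hl
  have := (hasSum_envMul_sq hα (f t)).summable
  simp only [hf] at this
  exact this.hasSum

theorem IsMarkovSemigroup.weightedEnergy_mono (hκ : IsMarkovSemigroup κ)
    (hgen : HasGenerator κ (rwGenerator α)) (hα : ∀ z, 1 ≤ α z ∧ α z ≤ c) (y : Fin d → ℤ)
    {l l' : ℝ} (hl0 : 0 ≤ l) (hll : l ≤ l') (hl : l' ≤ 1) (t : ℝ≥0) :
    weightedEnergy κ α y l t ≤ weightedEnergy κ α y l' t := by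
  refine hasSum_le (fun z => ?_) (hκ.hasSum_weightedEnergy hgen hα y hl0 (hll.trans hl) t)
    (hκ.hasSum_weightedEnergy hgen hα y (hl0.trans hll) hl t)
  have := l1Norm_nonneg (z - y)
  gcongr

theorem IsMarkovSemigroup.weightedEnergy_zero (hκ : IsMarkovSemigroup κ) (y : Fin d → ℤ)
    (l : ℝ) : weightedEnergy κ α y l 0 = α y := by
  rw [weightedEnergy, tsum_eq_single y]
  · simp [hκ.real_zero, l1Norm_zero]
  · intro z hz
    simp [hκ.real_zero, hz]

/-- The differential inequalities for the weighted energy. -/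
theorem IsMarkovSemigroup.exists_deriv_weightedEnergy (hκ : IsMarkovSemigroup κ)
    (hgen : HasGenerator κ (rwGenerator α)) (hα : ∀ z, 1 ≤ α z ∧ α z ≤ c) (hd : 1 ≤ d)
    (y : Fin d → ℤ) {l : ℝ} (hl0 : 0 ≤ l) (hl : l ≤ 1) :
    ∃ G G' : ℝ → ℝ, (∀ t, HasDerivAt G (G' t) t) ∧
      (∀ t : ℝ≥0, G t = weightedEnergy κ α y l t) ∧
      (∀ t, G' t ≤ 4 * d * c * l ^ 2 * G t) ∧
      ∀ (t : ℝ≥0) (r : ℕ), 0 < r →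
        Summable (fun z => Real.exp (l * l1Norm (z - y)) * (κ t z).real {y}) →
        G' t ≤ (4 * d * c * l ^ 2 - 1 / (c * d * r ^ 2)) * G t + 2 / (d * r ^ (d + 2)) *
          (∑' z, Real.exp (l * l1Norm (z - y)) * (κ t z).real {y}) ^ 2 := by
  obtain ⟨f, hf, hfκ⟩ := hκ.exists_weighted_solution hgen hα y hl0 hl
  set A := tiltedGenerator hα (abs_l1Norm_weight_sub_le hl0 y) hl with hA
  have hE : ∀ t, 2 * inner ℝ (envMul hα (f t)) (A (f t)) ≤
      -(2 * (f t).dirichlet) + 4 * d * c * l ^ 2 * inner ℝ (envMul hα (f t)) (f t) := by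
    intro t
    have := inner_tiltedGenerator_le hα (abs_l1Norm_weight_sub_le hl0 y) hl (f t)
    linarith
  refine ⟨fun t => inner ℝ (envMul hα (f t)) (f t),
    fun t => 2 * inner ℝ (envMul hα (f t)) (A (f t)), fun t => ?_, fun t => ?_, fun t => ?_, ?_⟩
  · have h := (((envMul hα).hasFDerivAt.comp_hasDerivAt t (hf t)).inner ℝ (hf t))
    refine h.congr_deriv ?_
    rw [inner_envMul_comm hα (A (f t)) (f t), real_inner_comm (envMul hα (f t)) (A (f t))]
    exact (two_mul _).symm
  · refine (hasSum_envMul_sq hα (f t)).unique ?_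
    simp only [hfκ]
    exact hκ.hasSum_weightedEnergy hgen hα y hl0 hl t
  · have h0 : 0 ≤ (f t).dirichlet := Finset.sum_nonneg fun _ _ => sq_nonneg _
    linarith [hE t]
  · intro t r hr hs
    have habs : ∀ z, |f t z| = Real.exp (l * l1Norm (z - y)) * (κ t z).real {y} := by
      intro z
      rw [hfκ, abs_of_nonneg (mul_nonneg (Real.exp_pos _).le measureReal_nonneg)]
    have hN := (f t).norm_sq_le_dirichlet (by simpa only [habs] using hs) hr
    simp only [habs] at hN
    set L := ∑' z, Real.exp (l * l1Norm (z - y)) * (κ t z).real {y}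
    have h1 := inner_envMul_le_norm_sq hα (f t)
    set D := (f t).dirichlet
    set F := inner ℝ (envMul hα (f t)) (f t)
    have hc : (0 : ℝ) < c := by exact_mod_cast (hα y).1.trans (hα y).2
    have hd' : (0 : ℝ) < d := by exact_mod_cast hd
    have hr' : (0 : ℝ) < r := by exact_mod_cast hr
    have h2 : F / c ≤ 2 * d * r ^ 2 * D + 2 / r ^ d * L ^ 2 := by
      rw [div_le_iff₀ hc]
      linarith [mul_le_mul_of_nonneg_left hN hc.le]
    -- The factor is chosen so that the Dirichlet term becomes exactly the `2 D` of the energy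
    -- estimate.
    have h3 : 1 / (d * r ^ 2) * (F / c) ≤
        1 / (d * r ^ 2) * (2 * d * r ^ 2 * D + 2 / r ^ d * L ^ 2) := by gcongr
    have h4 : 1 / (d * (r : ℝ) ^ 2) * (2 * d * r ^ 2 * D + 2 / r ^ d * L ^ 2) =
        2 * D + 2 / (d * r ^ (d + 2)) * L ^ 2 := by
      field_simp
      ring
    have h5 : 1 / (d * (r : ℝ) ^ 2) * (F / c) = 1 / (c * d * r ^ 2) * F := by
      field_simp
    have := hE t
    linarith

theorem IsMarkovSemigroup.weightedEnergy_le_exp_mul (hκ : IsMarkovSemigroup κ)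
    (hgen : HasGenerator κ (rwGenerator α)) (hα : ∀ z, 1 ≤ α z ∧ α z ≤ c) (hd : 1 ≤ d)
    (y : Fin d → ℤ) {l : ℝ} (hl0 : 0 ≤ l) (hl : l ≤ 1) {s t : ℝ≥0} (hst : s ≤ t) :
    weightedEnergy κ α y l t ≤
      Real.exp (4 * d * c * l ^ 2 * (t - s)) * weightedEnergy κ α y l s := by
  obtain ⟨G, G', hG, hGe, hG', -⟩ := hκ.exists_deriv_weightedEnergy hgen hα hd y hl0 hl
  rw [← hGe, ← hGe]
  exact le_exp_mul_of_deriv_le (NNReal.coe_le_coe.2 hst) hG fun x _ => hG' x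

/-- The sum over starting points is not a total probability, but reversibility compares it with one
at the cost of the factor `c`. -/
theorem IsMarkovSemigroup.summable_real_left (hκ : IsMarkovSemigroup κ)
    (hgen : HasGenerator κ (rwGenerator α)) (hα : ∀ z, 1 ≤ α z ∧ α z ≤ c) (t : ℝ≥0)
    (y : Fin d → ℤ) :
    Summable (fun z => (κ t z).real {y}) ∧ ∑' z, (κ t z).real {y} ≤ c := by
  have hle : ∀ z, (κ t z).real {y} ≤ c * (κ t y).real {z} := by
    intro z
    rw [hκ.real_symm hgen hα]
    have h1 : (1 : ℝ) ≤ α z := by exact_mod_cast (hα z).1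
    have h2 : (α y : ℝ) ≤ c := by exact_mod_cast (hα y).2
    gcongr
    exact (div_le_self (by positivity) h1).trans h2
  have hs := (hκ.hasSum_real t y).mul_left (c : ℝ)
  have hsum := hs.summable.of_nonneg_of_le (fun _ => measureReal_nonneg) hle
  exact ⟨hsum, (hasSum_le hle hsum.hasSum hs).trans_eq (mul_one _)⟩

/-- A weighted `ℓ¹` bound by interpolation between conservation of mass and the weighted energy. -/
theorem IsMarkovSemigroup.summable_exp_mul_real (hκ : IsMarkovSemigroup κ)
    (hgen : HasGenerator κ (rwGenerator α)) (hα : ∀ z, 1 ≤ α z ∧ α z ≤ c)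
    (y : Fin d → ℤ) {l : ℝ} (hl0 : 0 < l) (hl : 3 * l ≤ 1) (t : ℝ≥0) :
    Summable (fun z => Real.exp (l * l1Norm (z - y)) * (κ t z).real {y}) ∧
    ((∑' z, Real.exp (l * l1Norm (z - y)) * (κ t z).real {y}) ^ 2) ^ 2 ≤
      c ^ 2 * (weightedEnergy κ α y (3 * l) t * (3 / l) ^ d) := by
  have hp : ∀ z, 0 ≤ (κ t z).real {y} := fun z => measureReal_nonneg
  obtain ⟨s0, b0⟩ := hκ.summable_real_left hgen hα t y
  have s1 := hκ.hasSum_weightedEnergy hgen hα y (by positivity) hl t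
  have s1' : Summable fun z => (Real.exp (3 * l * l1Norm (z - y)) * (κ t z).real {y}) ^ 2 :=
    s1.summable.of_nonneg_of_le (fun _ => sq_nonneg _) fun z =>
      le_mul_of_one_le_left (sq_nonneg _) (by exact_mod_cast (hα z).1)
  have b1 : ∑' z, (Real.exp (3 * l * l1Norm (z - y)) * (κ t z).real {y}) ^ 2 ≤
      weightedEnergy κ α y (3 * l) t :=
    hasSum_le (fun z => le_mul_of_one_le_left (sq_nonneg _) (by exact_mod_cast (hα z).1))
      s1'.hasSum s1
  obtain ⟨s2, b2⟩ := tsum_exp_neg_l1Norm_le (b := 2 * l) (by positivity) (by linarith) y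
  have e2 : 6 / (2 * l) = 3 / l := by field_simp; norm_num
  rw [e2] at b2
  -- Cauchy–Schwarz with `e^{4l} = e^{6l} e^{-2l}` (exponents per unit distance): the weight `2l` is
  -- bounded by the energy at `3l` times an exponential sum.
  obtain ⟨s3, b3⟩ := summable_and_sq_tsum_le
    (h := fun z => Real.exp (2 * l * l1Norm (z - y)) * (κ t z).real {y})
    (fun z => mul_nonneg (Real.exp_pos _).le (hp z)) (fun z => sq_nonneg _)
    (fun z => (Real.exp_pos _).le) (fun z => by
      have h : Real.exp (2 * l * l1Norm (z - y)) ^ 2 = Real.exp (3 * l * l1Norm (z - y)) ^ 2 *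
          Real.exp (-(2 * l * l1Norm (z - y))) := by
        rw [← Real.exp_nat_mul, ← Real.exp_nat_mul, ← Real.exp_add]
        push_cast
        ring_nf
      rw [mul_pow, mul_pow, h]
      ring) s1'.hasSum s2.hasSum
  -- A second Cauchy–Schwarz between weights `0` and `2l` brings in the unweighted mass.
  obtain ⟨s4, b4⟩ := summable_and_sq_tsum_le
    (h := fun z => Real.exp (l * l1Norm (z - y)) * (κ t z).real {y})
    (fun z => mul_nonneg (Real.exp_pos _).le (hp z)) hp
    (fun z => mul_nonneg (Real.exp_pos _).le (hp z)) (fun z => by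
      have h : Real.exp (l * l1Norm (z - y)) ^ 2 = Real.exp (2 * l * l1Norm (z - y)) := by
        rw [← Real.exp_nat_mul]
        push_cast
        ring_nf
      rw [mul_pow, h]
      ring) s0.hasSum s3.hasSum
  refine ⟨s4, ?_⟩
  set I1 := ∑' z, Real.exp (l * l1Norm (z - y)) * (κ t z).real {y}
  set I2 := ∑' z, Real.exp (2 * l * l1Norm (z - y)) * (κ t z).real {y}
  have hI2 : I2 ^ 2 ≤ weightedEnergy κ α y (3 * l) t * (3 / l) ^ d :=
    b3.trans (mul_le_mul b1 b2 (tsum_nonneg fun _ => (Real.exp_pos _).le)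
      (weightedEnergy_nonneg _ _ _))
  have hI20 : 0 ≤ I2 := tsum_nonneg fun z => mul_nonneg (Real.exp_pos _).le (hp z)
  calc (I1 ^ 2) ^ 2 ≤ (c * I2) ^ 2 := by
        gcongr
        exact b4.trans (mul_le_mul_of_nonneg_right b0 hI20)
    _ = c ^ 2 * I2 ^ 2 := mul_pow _ _ _
    _ ≤ _ := by gcongr

end WeightedEnergy

/-! ### The bootstrap and the diagonal-to-pointwise step -/

section HeatKernelBound

variable {d : ℕ} {α : (Fin d → ℤ) → ℕ} {c : ℕ}
  {κ : ℝ≥0 → Kernel (Fin d → ℤ) (Fin d → ℤ)}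

/-- The ratio between the diffusive scale and the scale of averaging. -/
def scaleRatio (d c : ℕ) : ℕ := c * d * (3 ^ (d + 1) + 4 * d * c)

/-- The constant in front of the inhomogeneous term in the bootstrap of the weighted energy. -/
noncomputable def bootstrapConst (d c : ℕ) : ℝ :=
  (2 * scaleRatio d c) ^ (d + 2) * (c * Real.exp (18 * d * c) * 3 ^ d)

theorem exists_averaging_scale {q : ℕ} (hq : 1 ≤ q) {x : ℝ} (hx : q ≤ x) :
    ∃ r : ℕ, 0 < r ∧ (r : ℝ) * q ≤ x ∧ x ≤ 2 * q * r := by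
  have hq' : (0 : ℝ) < q := by exact_mod_cast hq
  have h1 : 1 ≤ x / q := (one_le_div hq').2 hx
  refine ⟨⌊x / q⌋₊, Nat.floor_pos.2 h1, ?_, ?_⟩
  · rw [← le_div_iff₀ hq']
    exact Nat.floor_le (by linarith)
  · have h2 := (Nat.lt_floor_add_one (x / q)).le
    have h3 : (1 : ℝ) ≤ ⌊x / q⌋₊ := by exact_mod_cast Nat.floor_pos.2 h1
    rw [div_le_iff₀ hq'] at h2
    nlinarith

/-- If the weighted energy has the right size at time `t / 9`, it has the right size at time `t`. -/
theorem IsMarkovSemigroup.weightedEnergy_bootstrap (hκ : IsMarkovSemigroup κ)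
    (hgen : HasGenerator κ (rwGenerator α)) (hα : ∀ z, 1 ≤ α z ∧ α z ≤ c) (hd : 1 ≤ d)
    (y : Fin d → ℤ) {S x : ℝ} (hS : 2 * bootstrapConst d c ≤ S) (hx3 : 3 ≤ x)
    (hx : scaleRatio d c ≤ x) {s t : ℝ≥0} (hs : (s : ℝ) = x ^ 2 / 9) (ht : (t : ℝ) = x ^ 2)
    (hprev : weightedEnergy κ α y (3 * (1 / x)) s ≤ S ^ 2 * (3 * (1 / x)) ^ d) :
    weightedEnergy κ α y (1 / x) t ≤ S ^ 2 * (1 / x) ^ d := by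
  have hx0 : 0 < x := by linarith
  set l : ℝ := 1 / x with hl
  have hl0 : 0 < l := by positivity
  have hlx : l * x = 1 := by rw [hl]; field_simp
  have hl3 : 3 * l ≤ 1 := by nlinarith
  have hl1 : l ≤ 1 := by linarith
  have hc1 : 1 ≤ c := (hα y).1.trans (hα y).2
  have hc : (1 : ℝ) ≤ c := by exact_mod_cast hc1
  have hd' : (1 : ℝ) ≤ d := by exact_mod_cast hd
  set q := scaleRatio d c with hq
  have hq1 : 1 ≤ q := by
    have : 0 < c * d * (3 ^ (d + 1) + 4 * d * c) := by positivity
    exact this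
  set C := bootstrapConst d c with hC
  set Λ : ℝ := c * Real.exp (18 * d * c) * 3 ^ d with hΛ
  have hΛ0 : 0 < Λ := by positivity
  have hC0 : 0 ≤ C := by rw [hC, bootstrapConst]; positivity
  have hS0 : 0 ≤ S := by linarith
  have hst : s ≤ t := by
    rw [← NNReal.coe_le_coe, hs, ht]
    linarith [sq_nonneg x]
  obtain ⟨r, hr, hrq, hrx⟩ := exists_averaging_scale hq1 hx
  have hr' : (0 : ℝ) < r := by exact_mod_cast hr
  -- the weighted mass on the time interval
  have hmass : ∀ u : ℝ≥0, s ≤ u → u ≤ t →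
      (∑' z, Real.exp (l * l1Norm (z - y)) * (κ u z).real {y}) ^ 2 ≤ Λ * S := by
    intro u hsu hut
    have h1 := (hκ.summable_exp_mul_real hgen hα y hl0 hl3 u).2
    have h2 := hκ.weightedEnergy_le_exp_mul hgen hα hd y (by positivity) hl3 hsu
    have h3 : 4 * d * c * (3 * l) ^ 2 * ((u : ℝ) - s) ≤ 36 * d * c := by
      have hu : (u : ℝ) - s ≤ x ^ 2 := by
        rw [← ht]
        linarith [NNReal.coe_le_coe.2 hut, s.coe_nonneg]
      calc 4 * d * c * (3 * l) ^ 2 * ((u : ℝ) - s) ≤ 4 * d * c * (3 * l) ^ 2 * x ^ 2 := by gcongr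
        _ = 36 * d * c * (l * x) ^ 2 := by ring
        _ = 36 * d * c := by rw [hlx]; ring
    have h4 : weightedEnergy κ α y (3 * l) u ≤
        Real.exp (36 * d * c) * (S ^ 2 * (3 * l) ^ d) := by
      refine h2.trans ?_
      gcongr
      exact weightedEnergy_nonneg _ _ _
    -- The powers of `l` cancel, so the squared weighted mass is bounded by `Λ S` independently of
    -- the scale, and only linearly in `S`.
    have h5 : (c : ℝ) ^ 2 * (Real.exp (36 * d * c) * (S ^ 2 * (3 * l) ^ d) * (3 / l) ^ d) =
        (Λ * S) ^ 2 := by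
      have e1 : Real.exp (36 * d * c) = Real.exp (18 * d * c) ^ 2 := by
        rw [← Real.exp_nat_mul]
        push_cast
        ring_nf
      have e2 : (3 * l) ^ d * (3 / l) ^ d = (3 ^ d) ^ 2 := by
        rw [← mul_pow, ← pow_mul, mul_comm d 2, pow_mul]
        congr 1
        field_simp
      calc _ = (c : ℝ) ^ 2 * Real.exp (36 * d * c) * S ^ 2 * ((3 * l) ^ d * (3 / l) ^ d) := by ring
        _ = _ := by rw [e1, e2, hΛ]; ring
    refine le_of_sq_le_sq ?_ (by positivity)
    rw [← h5]
    refine h1.trans ?_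
    gcongr
  obtain ⟨G, G', hG, hGe, -, hG'⟩ := hκ.exists_deriv_weightedEnergy hgen hα hd y hl0.le hl1
  -- Large enough that decay over time `8x²/9` at rate `M l²` beats the loss `2 · 3^d`: the factor
  -- `3^d` comes from the earlier scale, the `2` leaves room for the source term.
  set M : ℝ := 3 ^ (d + 1) with hM
  have hM0 : 0 < M := by positivity
  set H : ℝ := 2 / (d * r ^ (d + 2)) * (Λ * S) with hH
  have hode : ∀ u ∈ Set.Icc (s : ℝ) t, G' u ≤ -(M * l ^ 2) * G u + H := by
    intro u hu
    have hu0 : 0 ≤ u := s.coe_nonneg.trans hu.1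
    lift u to ℝ≥0 using hu0
    have h1 := hG' u r hr (hκ.summable_exp_mul_real hgen hα y hl0 hl3 u).1
    have h2 := hmass u (NNReal.coe_le_coe.1 hu.1) (NNReal.coe_le_coe.1 hu.2)
    have hG0 : 0 ≤ G u := by rw [hGe]; exact weightedEnergy_nonneg _ _ _
    -- `scaleRatio` is defined for this: with `r q ≤ x`, the Nash rate absorbs the Davies term `4dc
    -- l²` and still leaves `M l²`.
    have h3 : (M + 4 * d * c) * l ^ 2 ≤ 1 / (c * d * r ^ 2) := by
      rw [le_div_iff₀ (by positivity)]
      have h4 : (c : ℝ) * d * (M + 4 * d * c) = q := by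
        rw [hq, hM, scaleRatio]
        push_cast
        ring
      have h5 : (q : ℝ) ≤ q ^ 2 := by
        have : (1 : ℝ) ≤ q := by exact_mod_cast hq1
        nlinarith
      calc (M + 4 * d * c) * l ^ 2 * (c * d * r ^ 2)
          = (c * d * (M + 4 * d * c)) * (l * r) ^ 2 := by ring
        _ ≤ q ^ 2 * (l * r) ^ 2 := by rw [h4]; gcongr
        _ = (l * (r * q)) ^ 2 := by ring
        _ ≤ (l * x) ^ 2 := by gcongr
        _ = 1 := by rw [hlx, one_pow]
    have h6 : (4 * d * c * l ^ 2 - 1 / (c * d * r ^ 2)) * G u ≤ -(M * l ^ 2) * G u := by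
      gcongr
      linarith
    have h7 : 2 / (d * r ^ (d + 2)) *
        (∑' z, Real.exp (l * l1Norm (z - y)) * (κ u z).real {y}) ^ 2 ≤ H := by
      rw [hH]
      gcongr
    linarith
  have hgron := le_exp_mul_add_of_deriv_le (NNReal.coe_le_coe.2 hst) (by positivity)
    (by positivity) hG hode
  rw [hGe, hGe] at hgron
  have hfirst : Real.exp (-(M * l ^ 2) * (t - s)) * weightedEnergy κ α y l s ≤
      S ^ 2 * l ^ d / 2 := by
    have e1 : -(M * l ^ 2) * ((t : ℝ) - s) = -(8 / 9 * M) := by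
      rw [hs, ht]
      calc -(M * l ^ 2) * (x ^ 2 - x ^ 2 / 9) = -(8 / 9 * M) * (l * x) ^ 2 := by ring
        _ = _ := by rw [hlx]; ring
    have e2 : weightedEnergy κ α y l s ≤ S ^ 2 * (3 * l) ^ d :=
      (hκ.weightedEnergy_mono hgen hα y hl0.le (by linarith) hl3 s).trans hprev
    have e3 : Real.exp (-(8 / 9 * M)) * (2 * 3 ^ d) ≤ 1 := by
      rw [Real.exp_neg, inv_mul_le_iff₀ (Real.exp_pos _), mul_one]
      have h1 := Real.add_one_le_exp (8 / 9 * M)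
      have h2 : M = 3 * 3 ^ d := by rw [hM, pow_succ]; ring
      have h3 : (0 : ℝ) < 3 ^ d := by positivity
      rw [h2] at h1 ⊢
      linarith
    rw [e1]
    calc _ ≤ Real.exp (-(8 / 9 * M)) * (S ^ 2 * (3 * l) ^ d) := by gcongr
      _ = Real.exp (-(8 / 9 * M)) * (2 * 3 ^ d) * (S ^ 2 * l ^ d / 2) := by rw [mul_pow]; ring
      _ ≤ 1 * (S ^ 2 * l ^ d / 2) := by gcongr
      _ = _ := one_mul _
  -- Since `r` is at least `x / (2q)`, the source contributes at most `C S l^d`, and `2C ≤ S` makes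
  -- this half of the target.
  have hsecond : H / (M * l ^ 2) ≤ S ^ 2 * l ^ d / 2 := by
    have h1 : 1 ≤ 2 * q * (l * r) := by
      calc (1 : ℝ) = l * x := hlx.symm
        _ ≤ l * (2 * q * r) := by gcongr
        _ = _ := by ring
    have h2 : (1 : ℝ) ≤ (2 * q) ^ (d + 2) * (l ^ (d + 2) * r ^ (d + 2)) := by
      rw [← mul_pow, ← mul_pow]
      exact one_le_pow₀ h1
    have h3 : 2 / M ≤ 1 := by
      rw [div_le_one hM0, hM]
      calc (2 : ℝ) ≤ 3 ^ 1 := by norm_num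
        _ ≤ 3 ^ (d + 1) := pow_le_pow_right₀ (by norm_num) (by omega)
    have h4 : 1 / (r : ℝ) ^ (d + 2) ≤ (2 * q) ^ (d + 2) * l ^ (d + 2) := by
      rw [div_le_iff₀ (by positivity), mul_assoc]
      exact h2
    have h5 : 1 / (d : ℝ) ≤ 1 := by
      rw [div_le_one (by positivity)]
      exact hd'
    calc H / (M * l ^ 2) = (2 / M) * (1 / d) * (1 / (r : ℝ) ^ (d + 2)) * (Λ * S) / l ^ 2 := by
          rw [hH]
          field_simp
      _ ≤ 1 * 1 * ((2 * q) ^ (d + 2) * l ^ (d + 2)) * (Λ * S) / l ^ 2 := by gcongr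
      _ = C * S * l ^ d := by
          rw [hC, bootstrapConst, pow_add l, ← hq, ← hΛ]
          field_simp
      _ ≤ S / 2 * S * l ^ d := by
          gcongr
          linarith
      _ = _ := by ring
  linarith

/-- Uniform bound on the weighted energy at the diffusive scale. -/
theorem exists_weightedEnergy_bound (d c : ℕ) (hd : 1 ≤ d) :
    ∃ B : ℝ, 0 < B ∧ ∀ (α : (Fin d → ℤ) → ℕ), (∀ z, 1 ≤ α z ∧ α z ≤ c) →
      ∀ κ : ℝ≥0 → Kernel (Fin d → ℤ) (Fin d → ℤ), IsMarkovSemigroup κ →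
      HasGenerator κ (rwGenerator α) → ∀ (y : Fin d → ℤ) (t : ℝ≥0),
        weightedEnergy κ α y (1 / max 1 √(t : ℝ)) t ≤ B * (1 / max 1 √(t : ℝ)) ^ d := by
  -- Beyond `X` the bootstrap applies: `x ≥ 3` keeps the weight `3 / x` at most `1`, and `x ≥
  -- scaleRatio d c` leaves room for an averaging box.
  set X : ℝ := 3 + scaleRatio d c with hX
  have hX3 : 3 ≤ X := by rw [hX]; linarith [(scaleRatio d c).cast_nonneg (α := ℝ)]
  set b : ℝ := Real.exp (4 * d * c * X ^ 2) * c * X ^ d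
  have hb : 0 ≤ b := by positivity
  have hC : 0 ≤ bootstrapConst d c := by rw [bootstrapConst]; positivity
  -- The terms serve, in order, the bootstrap, the small times, and `S ≤ S ^ 2`.
  set S : ℝ := 2 * bootstrapConst d c + b + 1
  have hS1 : 1 ≤ S := by linarith
  refine ⟨S ^ 2, by positivity, fun α hα κ hκ hgen y => ?_⟩
  have key : ∀ n : ℕ, ∀ t : ℝ≥0, √(t : ℝ) ≤ 3 ^ n * X →
      weightedEnergy κ α y (1 / max 1 √(t : ℝ)) t ≤ S ^ 2 * (1 / max 1 √(t : ℝ)) ^ d := by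
    intro n
    induction n with
    | zero =>
      intro t ht
      rw [pow_zero, one_mul] at ht
      set m := max 1 √(t : ℝ)
      have hm1 : 1 ≤ m := le_max_left _ _
      have hmX : m ≤ X := max_le (by linarith) ht
      have hl1 : 1 / m ≤ 1 := (div_le_one (by positivity)).2 hm1
      have ht2 : (t : ℝ) ≤ X ^ 2 := (Real.sqrt_le_left (by linarith)).1 ht
      -- For bounded times, plain Grönwall from time `0` suffices.
      have h := hκ.weightedEnergy_le_exp_mul hgen hα hd y (l := 1 / m) (by positivity) hl1
        (zero_le (a := t))
      rw [hκ.weightedEnergy_zero, NNReal.coe_zero, sub_zero] at h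
      have h1 : (α y : ℝ) ≤ c := by exact_mod_cast (hα y).2
      have h2 : 1 ≤ X ^ d * (1 / m) ^ d := by
        rw [← mul_pow]
        refine one_le_pow₀ ?_
        rw [mul_one_div, one_le_div (by positivity)]
        exact hmX
      have h3 : 4 * d * c * (1 / m) ^ 2 * t ≤ 4 * d * c * X ^ 2 := by
        calc 4 * d * c * (1 / m) ^ 2 * (t : ℝ) ≤ 4 * d * c * 1 ^ 2 * X ^ 2 := by gcongr
          _ = _ := by ring
      calc _ ≤ Real.exp (4 * d * c * (1 / m) ^ 2 * t) * α y := h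
        _ ≤ Real.exp (4 * d * c * X ^ 2) * c := by gcongr
        _ ≤ Real.exp (4 * d * c * X ^ 2) * c * (X ^ d * (1 / m) ^ d) :=
            le_mul_of_one_le_right (by positivity) h2
        _ = b * (1 / m) ^ d := by ring
        _ ≤ S ^ 2 * (1 / m) ^ d := by
            gcongr
            nlinarith
    | succ n ih =>
      intro t ht
      rcases le_total √(t : ℝ) X with htX | htX
      · exact ih t (htX.trans (le_mul_of_one_le_left (by linarith) (one_le_pow₀ (by norm_num))))
      set x := √(t : ℝ) with hx
      have hx3 : 3 ≤ x := hX3.trans htX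
      have htx : (t : ℝ) = x ^ 2 := (Real.sq_sqrt t.coe_nonneg).symm
      have hsx : ((t / 9 : ℝ≥0) : ℝ) = x ^ 2 / 9 := by
        rw [NNReal.coe_div, htx]
        norm_num
      have hsqrt : √((t / 9 : ℝ≥0) : ℝ) = x / 3 := by
        rw [hsx, show x ^ 2 / 9 = (x / 3) ^ 2 by ring, Real.sqrt_sq (by linarith)]
      have hprev := ih (t / 9) (by
        rw [hsqrt, div_le_iff₀ (by norm_num)]
        calc x ≤ 3 ^ (n + 1) * X := ht
          _ = _ := by ring)
      have e : 1 / (x / 3) = 3 * (1 / x) := by field_simp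
      rw [hsqrt, max_eq_right (by linarith), e] at hprev
      rw [max_eq_right (by linarith)]
      refine hκ.weightedEnergy_bootstrap hgen hα hd y ?_ hx3 ?_ hsx htx hprev
      · linarith
      · linarith
  intro t
  obtain ⟨n, hn⟩ := pow_unbounded_of_one_lt √(t : ℝ) (by norm_num : (1 : ℝ) < 3)
  exact key n t (hn.le.trans (le_mul_of_one_le_right (by positivity) (by linarith)))

/-- The heat kernel is bounded by the weighted energies at half of the time. -/
theorem IsMarkovSemigroup.exp_mul_real_le (hκ : IsMarkovSemigroup κ)
    (hgen : HasGenerator κ (rwGenerator α)) (hα : ∀ z, 1 ≤ α z ∧ α z ≤ c)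
    (x y : Fin d → ℤ) {l : ℝ} (hl0 : 0 ≤ l) (hl : l ≤ 1) (s : ℝ≥0) :
    (Real.exp (l * l1Norm (x - y)) * (κ (s + s) x).real {y}) ^ 2 ≤
      weightedEnergy κ α x l s * weightedEnergy κ α y l s := by
  have hp : ∀ w z, 0 ≤ (κ s z).real {w} := fun w z => measureReal_nonneg
  set g : (Fin d → ℤ) → (Fin d → ℤ) → ℝ := fun w z =>
    Real.exp (l * l1Norm (z - w)) * (κ s z).real {w} with hg
  have hg0 : ∀ w z, 0 ≤ g w z := fun w z => mul_nonneg (Real.exp_pos _).le (hp w z)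
  obtain ⟨hsum, hle⟩ := summable_and_sq_tsum_le (h := fun z => α z * (g x z * g y z))
    (fun z => mul_nonneg (Nat.cast_nonneg _) (mul_nonneg (hg0 x z) (hg0 y z)))
    (fun z => by positivity) (fun z => by positivity) (fun z => by ring)
    (hκ.hasSum_weightedEnergy hgen hα x hl0 hl s) (hκ.hasSum_weightedEnergy hgen hα y hl0 hl s)
  refine le_trans ?_ hle
  have hCK := (hκ.hasSum_real_mul s s x y).mul_left (Real.exp (l * l1Norm (x - y)))
  have h0 : 0 ≤ Real.exp (l * l1Norm (x - y)) * (κ (s + s) x).real {y} :=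
    mul_nonneg (Real.exp_pos _).le measureReal_nonneg
  gcongr
  refine hasSum_le (fun z => ?_) hCK hsum.hasSum
  -- Reversal makes `x` the target of the first half, so both halves are kernels started at `z` and
  -- the factor `α z` supplies the energy's measure.
  have h1 : (κ s x).real {z} ≤ α z * (κ s z).real {x} := by
    rw [hκ.real_symm hgen hα s x z]
    refine mul_le_mul_of_nonneg_right (div_le_self (Nat.cast_nonneg _) ?_) (hp x z)
    exact_mod_cast (hα x).1
  have h2 : Real.exp (l * l1Norm (x - y)) ≤
      Real.exp (l * l1Norm (z - x)) * Real.exp (l * l1Norm (z - y)) := by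
    rw [← Real.exp_add, ← mul_add, Real.exp_le_exp]
    refine mul_le_mul_of_nonneg_left ?_ hl0
    have := l1Norm_add_le (x - z) (z - y)
    rwa [sub_add_sub_cancel, l1Norm_sub_comm x z] at this
  calc _ ≤ Real.exp (l * l1Norm (z - x)) * Real.exp (l * l1Norm (z - y)) *
        (α z * (κ s z).real {x} * (κ s z).real {y}) := by
        have := hp y z
        have := hp x z
        gcongr
    _ = _ := by
      simp only [hg]
      ring

end HeatKernelBound

/-! ### From the semigroup to the process, and conclusion -/

/-- The one-dimensional distributions of a Markov process are given by its semigroup. -/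
theorem IsMarkovProcess.real_eq {Ω E : Type*} [MeasurableSpace Ω] [MeasurableSpace E]
    [TopologicalSpace E] [MeasurableSingletonClass E] {κ : ℝ≥0 → Kernel E E} {x : E}
    {P : Measure Ω} [IsProbabilityMeasure P] {X : ℝ≥0 → Ω → E} (h : IsMarkovProcess κ x P X)
    (t : ℝ≥0) (y : E) : P.real {ω | X t ω = y} = (κ t x).real {y} := by
  have hy : MeasurableSet ({y} : Set E) := MeasurableSet.singleton y
  have hmeas : Measurable (Set.indicator {y} (1 : E → ℝ)) := measurable_one.indicator hy
  -- The Markov property at time `0`, where the position is almost surely `x`, gives the law at time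
  -- `t` after taking expectations.
  have hm := h.markov 0 t (Set.indicator {y} 1) hmeas
    ⟨1, fun z => by by_cases hz : z ∈ ({y} : Set E) <;> simp [hz]⟩
  have hpast : pastOf X 0 ≤ ‹MeasurableSpace Ω› :=
    iSup₂_le fun u _ => (h.measurable u).comap_le
  have h1 : ∫ ω, Set.indicator {y} (1 : E → ℝ) (X (0 + t) ω) ∂P = P.real {ω | X t ω = y} := by
    rw [zero_add]
    exact integral_indicator_one ((h.measurable t) hy)
  rw [← h1, ← integral_condExp hpast, integral_congr_ae hm]
  have h2 : (fun ω => ∫ z, Set.indicator {y} (1 : E → ℝ) z ∂(κ t (X 0 ω))) =ᵐ[P]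
      fun _ => (κ t x).real {y} := by
    filter_upwards [h.start] with ω hω
    rw [hω, integral_indicator_one hy]
  rw [integral_congr_ae h2]
  simp

theorem max_one_sqrt_pow (t : ℝ) (ht : 0 ≤ t) (d : ℕ) : max 1 √(t ^ d) = (max 1 √t) ^ d := by
  have hs : √(t ^ d) = √t ^ d := by
    rw [Real.sqrt_eq_iff_mul_self_eq (by positivity) (by positivity), ← mul_pow,
      Real.mul_self_sqrt ht]
  rw [hs]
  rcases le_total 1 √t with h | h
  · rw [max_eq_right h, max_eq_right (one_le_pow₀ h)]
  · rw [max_eq_left h, max_eq_left (pow_le_one₀ (Real.sqrt_nonneg _) h), one_pow]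

theorem proposition3p7 (d : ℕ) (hd : 1 ≤ d) (𝔠 : ℕ) :
    ∃ c : ℝ, 0 < c ∧
      ∀ α : (Fin d → ℤ) → ℕ, (∀ z, 1 ≤ α z ∧ α z ≤ 𝔠) →
      ∀ x : Fin d → ℤ,
      ∀ (Ω : Type*) [MeasurableSpace Ω] (P : Measure Ω) [IsProbabilityMeasure P]
        (X : ℝ≥0 → Ω → (Fin d → ℤ)), IsRandomWalk α x P X →
      ∀ t : ℝ≥0, 0 < t → ∀ y : Fin d → ℤ,
        P.real {ω | X t ω = y} ≤
          c / max 1 (√((t : ℝ) ^ d)) * Real.exp (-(euclNorm (x - y) / max 1 (√(t : ℝ)))) := by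
  obtain ⟨B, hB, hbound⟩ := exists_weightedEnergy_bound d 𝔠 hd
  -- The factor `2 ^ d` pays for replacing the scale of time `t / 2` by that of `t`.
  refine ⟨B * 2 ^ d, by positivity, ?_⟩
  rintro α hα x Ω _ P _ X ⟨κ, hκ, hgen, hX⟩ t - y
  rw [hX.real_eq, max_one_sqrt_pow _ t.coe_nonneg]
  set m := max 1 √(t : ℝ)
  have hm1 : 1 ≤ m := le_max_left _ _
  have hm0 : 0 < m := by linarith
  set s : ℝ≥0 := t / 2
  have hst : s + s = t := add_halves t
  have hs : (s : ℝ) = t / 2 := by simp [s]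
  set n := max 1 √(s : ℝ)
  have hn1 : 1 ≤ n := le_max_left _ _
  have hn0 : 0 < n := by linarith
  have hnm : n ≤ m := by
    refine max_le_max le_rfl (Real.sqrt_le_sqrt ?_)
    rw [hs]
    linarith [t.coe_nonneg]
  have hmn : m ≤ 2 * n := by
    refine max_le (by linarith) ?_
    have h1 : √(t : ℝ) ≤ 2 * √(s : ℝ) := by
      refine Real.sqrt_le_iff.2 ⟨by positivity, ?_⟩
      rw [mul_pow, Real.sq_sqrt s.coe_nonneg, hs]
      linarith [t.coe_nonneg]
    linarith [le_max_right 1 √(s : ℝ)]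
  have hl0 : 0 ≤ 1 / m := by positivity
  have hlm : 1 / m ≤ 1 / n := one_div_le_one_div_of_le hn0 hnm
  have hln : 1 / n ≤ 1 := (div_le_one hn0).2 hn1
  -- The weight `1 / m` is the one wanted in the exponent; it is at most the natural weight `1 / n`
  -- at time `s`, and the energy increases with the weight.
  have hE : ∀ w, weightedEnergy κ α w (1 / m) s ≤ B * (1 / n) ^ d := fun w =>
    (hκ.weightedEnergy_mono hgen hα w hl0 hlm hln s).trans (hbound α hα κ hκ hgen w s)
  have hBn : 0 ≤ B * (1 / n) ^ d := by positivity
  have hmain : Real.exp (1 / m * l1Norm (x - y)) * (κ t x).real {y} ≤ B * (1 / n) ^ d := by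
    refine le_of_sq_le_sq ?_ hBn
    rw [← hst]
    refine (hκ.exp_mul_real_le hgen hα x y hl0 (hlm.trans hln) s).trans ?_
    rw [sq]
    exact mul_le_mul (hE x) (hE y) (weightedEnergy_nonneg _ _ _) hBn
  have hscale : B * (1 / n) ^ d ≤ B * 2 ^ d / m ^ d := by
    have h1 : 1 / n ≤ 2 / m := by
      rw [div_le_div_iff₀ hn0 hm0]
      linarith
    rw [mul_div_assoc, ← div_pow]
    exact mul_le_mul_of_nonneg_left (pow_le_pow_left₀ (by positivity) h1 d) hB.le
  calc (κ t x).real {y}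
      = Real.exp (1 / m * l1Norm (x - y)) * (κ t x).real {y} *
        Real.exp (-(l1Norm (x - y) / m)) := by
        rw [mul_right_comm, ← Real.exp_add]
        ring_nf
        simp
    _ ≤ B * 2 ^ d / m ^ d * Real.exp (-(euclNorm (x - y) / m)) := by
        gcongr
        · exact hmain.trans hscale
        · exact euclNorm_le_l1Norm _
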